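/- Let $r\ge 1$ be an integer and let $S:\mathbb R^{r+1}\to\mathbb R$ be a local potential satisfying: (A) $S(x_0+1,\dots,x_r+1)=S(x_0,\dots,x_r)$; (B) $S$ is twice continuously differentiable, $\partial_{i}\partial_{k}S\le 0$ everywhere for all $i\ne k$, and $\partial_{0}\partial_{1}S<0$ everywhere; (C) $S$ is bounded from below and there is a $0\le k\le r-1$ such that $S(x_0,\dots,x_r)\to\infty$ as $|x_{k+1}-x_k|\to\infty$ (uniformly in the other variables). For integers $p>0$ and $q$ let $\mathbb X_{p,q}$ be the set of sequences $x:\mathbb Z\to\mathbb R$ with $x_{i-p}+q=x_i$ for all $i$, and let $W_{p,q}(x)=\sum_{j=0}^{p-1}S(x_j,\dots,x_{j+r})$. For a rational $q/p$ in lowest terms with $p>0$ and for $\xi\in\mathbb R$, define the periodic Peierls barrier $$P_{q/p}(\xi)=\min_{x\in\mathbb X_{p,q},\,x_0=\xi}W_{p,q}(x)-\min_{x\in\mathbb X_{p,q}}W_{p,q}(x).$$ For irrational $\omega$ define $P_\omega(\xi)=\lim_{q/p\to\omega}P_{q/p}(\xi)$, the limit being over all rationals $q/p$ tending to $\omega$.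 Then: 1. The minima in the definition of $P_{q/p}(\xi)$ are attained, and for every irrational $\omega$ and every $\xi\in\mathbb R$ the limit defining $P_\omega(\xi)$ exists. 2. For every $L>0$ there is a constant $C>0$ (depending only on $S$ and $L$) such that for all $\omega\in\mathbb R$ (rational or irrational) with $|\omega|\le L$, all coprime integers $p\neq0$ and $q$ with $|q/p|\le L$, and all $\xi\in\mathbb R$, $$|P_\omega(\xi)-P_{q/p}(\xi)|\le C\Big(\frac1{|p|}+|p\omega-q|\Big).$$ Moreover, $C$ can be chosen such that the following holds as well. If $|\omega|\le L$ and $\omega$ is Diophantine, that is, for some $\gamma>0$ and $\tau\ge1$ one has $|p\omega-q|\ge\gamma/|p|^{\tau}$ for all integers $p\ne0$ and $q$, then $$|P_\omega(\xi)-P_\Omega(\xi)|\le \frac{5C}{\gamma^{1/\tau}}\,|\Omega-\omega|^{1/(2\tau)}\quad\text{for all }\Omega\in\mathbb R\text{ with }|\Omega-\omega|\le1\text{ and all }\xi\in\mathbb R;$$ that is, $\omega\mapsto P_\omega(\xi)$ is Hölder continuous with exponent $1/(2\tau)$ at such $\omega$, uniformly in $\xi$. 3. At every irrational $\omega$ the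 map $\omega\mapsto P_\omega(\xi)$ is continuous, uniformly in $\xi$: $\sup_{\xi}|P_\Omega(\xi)-P_\omega(\xi)|\to0$ as $\Omega\to\omega$. -/

import Mathlib

open Filter Topology

noncomputable section

/-- The partial derivative of `f` in the direction of the `i`-th coordinate. -/
def partialDeriv {n : ℕ} (i : Fin n) (f : (Fin n → ℝ) → ℝ) (x : Fin n → ℝ) : ℝ :=
  fderiv ℝ f x (Pi.single i 1)

/-- The standing conditions on a local potential `S : ℝ^(r+1) → ℝ` of range `r`:
periodicity, monotonicity (twist) and coercivity. -/
structure IsLocalPotential {r : ℕ} (S : (Fin (r + 1) → ℝ) → ℝ) : Prop where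
  /-- A: `S(x_0 + 1, …, x_r + 1) = S(x_0, …, x_r)`. -/
  periodic : ∀ x : Fin (r + 1) → ℝ, S (fun i => x i + 1) = S x
  /-- B: `S` is twice continuously differentiable. -/
  contDiff : ContDiff ℝ 2 S
  /-- B: the mixed second order partial derivatives are nonpositive. -/
  monotone : ∀ (i k : Fin (r + 1)), i ≠ k → ∀ x, partialDeriv i (partialDeriv k S) x ≤ 0
  /-- B: the mixed second order partial derivative in the first two variables is negative. -/
  twist : ∀ x, partialDeriv 0 (partialDeriv 1 S) x < 0
  /-- C: `S` is bounded from below. -/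
  bddBelow : BddBelow (Set.range S)
  /-- C: for some `k < r`, `S(x) → ∞` as `|x_{k+1} - x_k| → ∞`. -/
  coercive : ∃ k : Fin r,
    Tendsto S (comap (fun x : Fin (r + 1) → ℝ => |x k.succ - x k.castSucc|) atTop) atTop

/-- The finite action `W_{[i₀, i₁]}(x) = ∑_{j ∈ [i₀, i₁]} S(x_j, …, x_{j+r})`. -/
def finiteAction {r : ℕ} (S : (Fin (r + 1) → ℝ) → ℝ) (i₀ i₁ : ℤ) (x : ℤ → ℝ) : ℝ :=
  ∑ j ∈ Finset.Icc i₀ i₁, S (fun i : Fin (r + 1) => x (j + ((i : ℕ) : ℤ)))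

/-- The translate `(τ_{k,l} x)_i = x_{i-k} + l`. -/
def seqTranslate (k l : ℤ) (x : ℤ → ℝ) : ℤ → ℝ := fun i => x (i - k) + (l : ℝ)

/-- The space of `(p,q)`-periodic sequences, `τ_{p,q} x = x`. -/
def periodicSeqs (p q : ℤ) : Set (ℤ → ℝ) := {x | seqTranslate p q x = x}

/-- The `(p,q)`-periodic sequences `x` with `x_0 = ξ`. -/
def pinnedPeriodicSeqs (p q : ℤ) (ξ : ℝ) : Set (ℤ → ℝ) := {x | x ∈ periodicSeqs p q ∧ x 0 = ξ}

/-- The periodic action `W_{p,q} = W_{[0, p-1]}`. -/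
def periodicAction {r : ℕ} (S : (Fin (r + 1) → ℝ) → ℝ) (p : ℤ) (x : ℤ → ℝ) : ℝ :=
  finiteAction S 0 (p - 1) x

/-- The periodic Peierls barrier `P_{q/p}(ξ)`, where `s = q/p` is in lowest terms and `p > 0`:
the minimum of `W_{p,q}` over the `(p,q)`-periodic `x` with `x_0 = ξ`, minus the minimum
of `W_{p,q}` over all `(p,q)`-periodic `x`. -/
def periodicPeierlsBarrier {r : ℕ} (S : (Fin (r + 1) → ℝ) → ℝ) (s : ℚ) (ξ : ℝ) : ℝ :=
  sInf (periodicAction S (s.den : ℤ) '' pinnedPeriodicSeqs (s.den : ℤ) s.num ξ) -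
    sInf (periodicAction S (s.den : ℤ) '' periodicSeqs (s.den : ℤ) s.num)

open Classical in
/-- The Peierls barrier `P_ω(ξ)` for `ω ∈ ℝ`: the periodic one at a rational `ω`, and
`lim_{q/p → ω} P_{q/p}(ξ)` at an irrational `ω`. -/
def peierlsBarrier {r : ℕ} (S : (Fin (r + 1) → ℝ) → ℝ) (ω ξ : ℝ) : ℝ :=
  if h : ∃ s : ℚ, (s : ℝ) = ω then periodicPeierlsBarrier S h.choose ξ
  else limUnder (comap (fun s : ℚ => (s : ℝ)) (𝓝 ω)) (fun s : ℚ => periodicPeierlsBarrier S s ξ)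

theorem peierlsBarrier_ratCast {r : ℕ} (S : (Fin (r + 1) → ℝ) → ℝ) (s : ℚ) (ξ : ℝ) :
    peierlsBarrier S (s : ℝ) ξ = periodicPeierlsBarrier S s ξ := by
  have h : ∃ t : ℚ, (t : ℝ) = (s : ℝ) := ⟨s, rfl⟩
  have hs : h.choose = s := Rat.cast_injective h.choose_spec
  unfold peierlsBarrier
  rw [dif_pos h, hs]

/-- `ω` is Diophantine with constants `γ > 0` and `τ ≥ 1`. -/
def IsDiophantine (γ τ ω : ℝ) : Prop :=
  0 < γ ∧ 1 ≤ τ ∧ ∀ p q : ℤ, p ≠ 0 → γ / |(p : ℝ)| ^ τ ≤ |(p : ℝ) * ω - (q : ℝ)|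

end

/-!
Write `X_{p,q}` for the `(p,q)`-periodic sequences, `W` for the action of a period and `H_{p,q}`
for its minimum on `X_{p,q}`; `barrier S p q` is then the barrier of `q/p`. The proof rests on
three facts.

*Submodularity.* As `∂ᵢ∂ₖS ≤ 0`, one has `W (x ⊓ y) + W (x ⊔ y) ≤ W x + W y`. So minimizers form a
lattice, and a minimizer that also minimizes a strictly submodular functional cannot cross its
translates. It is ordered like the sequence `i ↦ i q/p` (`exists_wellOrdered_minimizer`), hence has
bounded increments. Moreover a pinned sequence can be moved between two near-minimizers enclosing
the pin at no substantial cost (`exists_pinned_mem_Icc`).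

*Subadditivity without error*: `H_{p+p',q+q'} ≤ H_{p,q} + H_{p',q'}` (`minAction_add_le`).
Concatenating `2^m` periods of each minimizer costs a bounded amount, and
`2^m H_{p,q} ≤ H_{2^m p, 2^m q}`, since the minimum and maximum of `x ∈ X_{2p,2q}` and `τ_{p,q} x`
lie in `X_{p,q}`.

*Near returns.* For a well-ordered `y` of rotation number `Ω` the gaps `|y_{t+p} - q - y_t|` sum to
at most `2p|pΩ - q| + 1` over `p` consecutive sites (`WellOrdered.sum_gap_le`), and the distances
between two consecutive translates of `y` sum to `1` over a period. So among any `p` consecutive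
sites there is one at which all these quantities, also at the `r` sites following it, are
`O(1/p + |pΩ - q|)`.

Let `Ω = q'/p'` with `p' > p`, and cut at such a site. A sequence of `X_{p',q'}` lying between two
consecutive translates of a minimizer splits into a block of length `p` and a complement of length
`p' - p`, each of which closes up with a small error. The complement costs at least
`H_{p'-p,q'-q} ≥ H_{p',q'} - H_{p,q}`, so the closed block has no more excess action than the whole
sequence (`periodicAction_closeUp_sub_le`). For a pinned minimizer this bounds the barrier of `q/p`
by that of `q'/p'`. Conversely, closing up the two translates gives near-minimizers in `X_{p,q}`;
a pinned minimizer of `X_{p,q}` is moved between them and can then be glued into the translate.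
Hence `exists_barrier_estimate_of_lt`. The case `p = 1` shows that barriers are bounded, which
disposes of large `|pΩ - q|`, and `p' < p` follows by exchanging the roles.

At irrational `ω` the rationals with `|pω - q|` and `1/p` small make the barriers a Cauchy family,
uniformly in `ξ`. The Hölder estimate comes from comparing both barriers with that of the Dirichlet
approximation of `ω` of denominator at most `|Ω - ω| ^ (-1/2)`.
-/

noncomputable section

variable {r : ℕ} {S : (Fin (r + 1) → ℝ) → ℝ}

/-! ### Submodularity and Lipschitz bounds for the local potential -/

theorem fderiv_eq_sum_partialDeriv {n : ℕ} (f : (Fin n → ℝ) → ℝ) (x v : Fin n → ℝ) :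
    fderiv ℝ f x v = ∑ i, v i * partialDeriv i f x := by
  conv_lhs => rw [pi_eq_sum_univ' v]
  simp [partialDeriv, map_sum]

namespace IsLocalPotential

theorem contDiff_partialDeriv (hS : IsLocalPotential S) (k : Fin (r + 1)) :
    ContDiff ℝ 1 (partialDeriv k S) := by
  have h : ContDiff ℝ 1 (fderiv ℝ S) := hS.contDiff.fderiv_right (by norm_num)
  exact h.clm_apply contDiff_const

theorem differentiable (hS : IsLocalPotential S) : Differentiable ℝ S :=
  hS.contDiff.differentiable (by norm_num)

/-- By the sign of the mixed derivatives, `∂ₖS` does not increase in the directions of the other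
coordinates. -/
theorem partialDeriv_add_le (hS : IsLocalPotential S) (k : Fin (r + 1))
    (x a : Fin (r + 1) → ℝ) (ha : ∀ i, 0 ≤ a i) (hk : a k = 0) :
    partialDeriv k S (x + a) ≤ partialDeriv k S x := by
  have hd : Differentiable ℝ (partialDeriv k S) :=
    (hS.contDiff_partialDeriv k).differentiable (by norm_num)
  have hder : ∀ t : ℝ, HasDerivAt (fun t : ℝ => partialDeriv k S (x + t • a))
      (fderiv ℝ (partialDeriv k S) (x + t • a) a) t := fun t => by
    have h1 : HasDerivAt (fun t : ℝ => x + t • a) a t := by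
      simpa using ((hasDerivAt_id t).smul_const a).const_add x
    exact (hd _).hasFDerivAt.comp_hasDerivAt t h1
  have hanti : Antitone (fun t : ℝ => partialDeriv k S (x + t • a)) := by
    refine antitone_of_deriv_nonpos (fun t => (hder t).differentiableAt) fun t => ?_
    rw [(hder t).deriv, fderiv_eq_sum_partialDeriv]
    refine Finset.sum_nonpos fun i _ => ?_
    by_cases hik : i = k
    · simp [hik, hk]
    · exact mul_nonpos_of_nonneg_of_nonpos (ha i) (hS.monotone i k hik _)
  simpa using hanti (zero_le_one : (0 : ℝ) ≤ 1)

theorem add_add_le (hS : IsLocalPotential S) (m a b : Fin (r + 1) → ℝ)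
    (ha : ∀ i, 0 ≤ a i) (hb : ∀ i, 0 ≤ b i) (hab : ∀ i, a i = 0 ∨ b i = 0) :
    S (m + b + a) - S (m + b) ≤ S (m + a) - S m := by
  have hder : ∀ (c : Fin (r + 1) → ℝ) (t : ℝ), HasDerivAt (fun t : ℝ => S (m + t • b + c))
      (fderiv ℝ S (m + t • b + c) b) t := fun c t => by
    have h1 : HasDerivAt (fun t : ℝ => m + t • b + c) b t := by
      simpa using (((hasDerivAt_id t).smul_const b).const_add m).add_const c
    exact (hS.differentiable _).hasFDerivAt.comp_hasDerivAt t h1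
  have hder' : ∀ t : ℝ, HasDerivAt (fun t : ℝ => S (m + t • b + a) - S (m + t • b + 0))
      (fderiv ℝ S (m + t • b + a) b - fderiv ℝ S (m + t • b + 0) b) t :=
    fun t => (hder a t).sub (hder 0 t)
  have hanti : Antitone (fun t : ℝ => S (m + t • b + a) - S (m + t • b + 0)) := by
    refine antitone_of_deriv_nonpos (fun t => (hder' t).differentiableAt) fun t => ?_
    rw [(hder' t).deriv, fderiv_eq_sum_partialDeriv, fderiv_eq_sum_partialDeriv,
      ← Finset.sum_sub_distrib]
    refine Finset.sum_nonpos fun i _ => ?_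
    rw [← mul_sub]
    rcases hab i with h | h
    · refine mul_nonpos_of_nonneg_of_nonpos (hb i) (sub_nonpos.2 ?_)
      rw [add_zero]
      exact hS.partialDeriv_add_le i _ a ha h
    · simp [h]
  simpa using hanti (zero_le_one : (0 : ℝ) ≤ 1)

/-- A potential with nonpositive mixed derivatives is submodular: integrate
`∂ᵢ∂ₖS ≤ 0` over the rectangle spanned by `x - x ⊓ y` and `y - x ⊓ y`, whose supports are
disjoint. -/
theorem inf_add_sup_le (hS : IsLocalPotential S) (x y : Fin (r + 1) → ℝ) :
    S (x ⊓ y) + S (x ⊔ y) ≤ S x + S y := by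
  have h := hS.add_add_le (x ⊓ y) (x - x ⊓ y) (y - x ⊓ y)
    (fun i => by simp) (fun i => by simp)
    (fun i => by
      rcases le_total (x i) (y i) with h | h
      · left; simp [h]
      · right; simp [h])
  have e : x ⊓ y + (y - x ⊓ y) + (x - x ⊓ y) = x ⊔ y := by
    ext i
    have := min_add_max (x i) (y i)
    simp only [Pi.add_apply, Pi.sub_apply, Pi.inf_apply, Pi.sup_apply]
    linarith
  rw [e, add_sub_cancel, add_sub_cancel] at h
  linarith

theorem map_add_intCast (hS : IsLocalPotential S) (n : ℤ) (x : Fin (r + 1) → ℝ) :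
    S (fun i => x i + n) = S x := by
  induction n using Int.induction_on with
  | zero => simp
  | succ n ih =>
    rw [← ih, ← hS.periodic fun i => x i + ((n : ℤ) : ℝ)]
    congr 1; ext i; push_cast; ring
  | pred n ih =>
    rw [← ih, ← hS.periodic fun i => x i + ((-(n : ℤ) - 1 : ℤ) : ℝ)]
    congr 1; ext i; push_cast; ring

theorem fderiv_add_intCast (hS : IsLocalPotential S) (n : ℤ) (x : Fin (r + 1) → ℝ) :
    fderiv ℝ S (x + fun _ => (n : ℝ)) = fderiv ℝ S x := by
  rw [← fderiv_comp_add_right]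
  congr 1
  ext y
  exact hS.map_add_intCast n y

/-- On configurations of bounded oscillation `S` is Lipschitz for the sup norm: by periodicity
its derivative takes there only the values it has on a compact set. -/
theorem exists_lipschitz (hS : IsLocalPotential S) (M : ℝ) :
    ∃ K : ℝ, 0 < K ∧ ∀ u w : Fin (r + 1) → ℝ, (∀ i, |u i - u 0| ≤ M) → (∀ i, |w i - w 0| ≤ M) →
      ∀ E : ℝ, (∀ i, |u i - w i| ≤ E) → |S u - S w| ≤ K * E := by
  set B : Set (Fin (r + 1) → ℝ) := Set.pi Set.univ fun _ => Set.Icc (-|M|) (1 + |M|) with hB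
  have hBc : IsCompact B := isCompact_univ_pi fun _ => isCompact_Icc
  have hcont : Continuous (fderiv ℝ S) := hS.contDiff.continuous_fderiv (by norm_num)
  obtain ⟨K, hK⟩ := hBc.exists_bound_of_continuousOn hcont.continuousOn
  refine ⟨max K 1, lt_of_lt_of_le one_pos (le_max_right _ _), fun u w hu hw E hE => ?_⟩
  set T : Set (Fin (r + 1) → ℝ) := {u | ∀ i, |u i - u 0| ≤ M} with hT
  have hTconv : Convex ℝ T := by
    intro a ha b hb s t hs ht hst i
    have e : (s • a + t • b) i - (s • a + t • b) 0 = s * (a i - a 0) + t * (b i - b 0) := by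
      simp; ring
    rw [e]
    calc |s * (a i - a 0) + t * (b i - b 0)| ≤ |s * (a i - a 0)| + |t * (b i - b 0)| :=
          abs_add_le _ _
      _ = s * |a i - a 0| + t * |b i - b 0| := by
          rw [abs_mul, abs_mul, abs_of_nonneg hs, abs_of_nonneg ht]
      _ ≤ s * M + t * M := by
          have h1 := ha i; have h2 := hb i; gcongr
      _ = M := by rw [← add_mul, hst, one_mul]
  have hbound : ∀ x ∈ T, ‖fderiv ℝ S x‖ ≤ max K 1 := by
    intro x hx
    rw [← hS.fderiv_add_intCast (-⌊x 0⌋) x]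
    refine (hK _ fun i _ => ?_).trans (le_max_left _ _)
    have h1 := abs_le.1 ((hx i).trans (le_abs_self M))
    have h2 := Int.floor_le (x 0)
    have h3 := Int.lt_floor_add_one (x 0)
    simp only [Pi.add_apply, Int.cast_neg, Set.mem_Icc]
    constructor <;> linarith [h1.1, h1.2]
  have h := hTconv.norm_image_sub_le_of_norm_fderiv_le (f := S) (𝕜 := ℝ)
    (fun x _ => hS.differentiable x) hbound hw hu
  have hE0 : 0 ≤ E := (abs_nonneg _).trans (hE 0)
  have h2 : ‖u - w‖ ≤ E := (pi_norm_le_iff_of_nonneg hE0).2 fun i => hE i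
  rw [Real.norm_eq_abs] at h
  exact h.trans (by gcongr)

end IsLocalPotential

/-! ### Sums over integer intervals -/

theorem sum_Ico_add_sum_Ico {a b c : ℤ} (f : ℤ → ℝ) (hab : a ≤ b) (hbc : b ≤ c) :
    ∑ j ∈ Finset.Ico a b, f j + ∑ j ∈ Finset.Ico b c, f j = ∑ j ∈ Finset.Ico a c, f j := by
  rw [← Finset.Ico_union_Ico_eq_Ico hab hbc,
    Finset.sum_union (Finset.Ico_disjoint_Ico_consecutive a b c)]

theorem sum_Ico_shift (f : ℤ → ℝ) (a : ℤ) {p : ℤ} (hp : 0 ≤ p) :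
    ∑ j ∈ Finset.Ico (a + 1) (a + 1 + p), f j
      = ∑ j ∈ Finset.Ico a (a + p), f j + (f (a + p) - f a) := by
  have h1 := sum_Ico_add_sum_Ico f (show a ≤ a + 1 by omega) (show a + 1 ≤ a + 1 + p by omega)
  have h2 := sum_Ico_add_sum_Ico f (show a ≤ a + p by omega) (show a + p ≤ a + 1 + p by omega)
  have e1 : Finset.Ico a (a + 1) = {a} := by ext; simp; omega
  have e2 : Finset.Ico (a + p) (a + 1 + p) = {a + p} := by ext; simp; omega
  rw [e1, Finset.sum_singleton] at h1
  rw [e2, Finset.sum_singleton] at h2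
  linarith

theorem sum_Ico_of_periodic (f : ℤ → ℝ) {p : ℤ} (hp : 0 ≤ p) (hf : ∀ j, f (j + p) = f j) (a b : ℤ) :
    ∑ j ∈ Finset.Ico a (a + p), f j = ∑ j ∈ Finset.Ico b (b + p), f j := by
  have key : ∀ a : ℤ, ∑ j ∈ Finset.Ico a (a + p), f j = ∑ j ∈ Finset.Ico 0 (0 + p), f j := by
    intro a
    induction a using Int.induction_on with
    | zero => rfl
    | succ n ih => rw [sum_Ico_shift f _ hp, ih, hf]; ring
    | pred n ih =>
      have h := sum_Ico_shift f (-(n : ℤ) - 1) hp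
      rw [hf, sub_add_cancel, ih] at h
      linarith
  rw [key a, key b]

theorem sum_Ico_comp_add (f : ℤ → ℝ) (a b c : ℤ) :
    ∑ j ∈ Finset.Ico a b, f (j + c) = ∑ j ∈ Finset.Ico (a + c) (b + c), f j := by
  rw [← Finset.map_add_right_Ico, Finset.sum_map]
  rfl

/-- If only the last `r` terms of a sum over `[a, b)` can be positive and they are at most `E`,
the sum is at most `r * E`. -/
theorem sum_Ico_le_mul {a b : ℤ} {f : ℤ → ℝ} {E : ℝ} {r : ℕ} (hE : 0 ≤ E)
    (h0 : ∀ j ∈ Finset.Ico a b, j < b - r → f j ≤ 0)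
    (h1 : ∀ j ∈ Finset.Ico a b, f j ≤ E) :
    ∑ j ∈ Finset.Ico a b, f j ≤ r * E := by
  calc ∑ j ∈ Finset.Ico a b, f j
      ≤ ∑ j ∈ Finset.Ico a b, if b - r ≤ j then E else 0 := by
        refine Finset.sum_le_sum fun j hj => ?_
        split_ifs with h
        · exact h1 j hj
        · exact h0 j hj (not_le.1 h)
    _ = ∑ j ∈ (Finset.Ico a b).filter (fun j => b - r ≤ j), E := (Finset.sum_filter _ _).symm
    _ ≤ ∑ j ∈ Finset.Ico (b - r) b, E := by
        refine Finset.sum_le_sum_of_subset_of_nonneg ?_ fun _ _ _ => hE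
        intro j; simp; omega
    _ = r * E := by simp

/-! ### Periodic sequences and their action -/

theorem mem_periodicSeqs_iff {p q : ℤ} {x : ℤ → ℝ} :
    x ∈ periodicSeqs p q ↔ ∀ i, x (i + p) = x i + q := by
  constructor
  · intro h i
    have := congrFun (show seqTranslate p q x = x from h) (i + p)
    simpa [seqTranslate] using this.symm
  · intro h
    refine funext fun i => ?_
    have := h (i - p)
    simp only [sub_add_cancel] at this
    exact this.symm

theorem seqTranslate_mem {p q : ℤ} {x : ℤ → ℝ} (hx : x ∈ periodicSeqs p q) (k l : ℤ) :
    seqTranslate k l x ∈ periodicSeqs p q := by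
  rw [mem_periodicSeqs_iff] at hx ⊢
  intro i
  have := hx (i - k)
  simp only [seqTranslate]
  rw [show i + p - k = i - k + p by ring, this]
  ring

theorem inf_mem_periodicSeqs {p q : ℤ} {x y : ℤ → ℝ} (hx : x ∈ periodicSeqs p q)
    (hy : y ∈ periodicSeqs p q) : x ⊓ y ∈ periodicSeqs p q := by
  rw [mem_periodicSeqs_iff] at *
  intro i
  simp only [Pi.inf_apply]
  rw [hx, hy, min_add_add_right]

theorem sup_mem_periodicSeqs {p q : ℤ} {x y : ℤ → ℝ} (hx : x ∈ periodicSeqs p q)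
    (hy : y ∈ periodicSeqs p q) : x ⊔ y ∈ periodicSeqs p q := by
  rw [mem_periodicSeqs_iff] at *
  intro i
  simp only [Pi.sup_apply]
  rw [hx, hy, max_add_add_right]

theorem periodicSeqs_mul {p q : ℤ} {x : ℤ → ℝ} (hx : x ∈ periodicSeqs p q) (n i : ℤ) :
    x (i + n * p) = x i + n * q := by
  rw [mem_periodicSeqs_iff] at hx
  induction n using Int.induction_on with
  | zero => simp
  | succ n ih =>
    rw [show i + ((n : ℤ) + 1) * p = i + n * p + p by ring, hx, ih]; push_cast; ring
  | pred n ih =>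
    have := hx (i + (-(n : ℤ) - 1) * p)
    rw [show i + (-(n : ℤ) - 1) * p + p = i + -(n : ℤ) * p by ring, ih] at this
    push_cast at this ⊢; linarith

theorem periodicSeqs_subset_mul (p q n : ℤ) : periodicSeqs p q ⊆ periodicSeqs (n * p) (n * q) := by
  intro x hx
  rw [mem_periodicSeqs_iff]
  intro i
  rw [periodicSeqs_mul hx]; push_cast; rfl

theorem linear_mem_periodicSeqs {p q : ℤ} (hp : 0 < p) (c : ℝ) :
    (fun i : ℤ => c + i * ((q : ℝ) / p)) ∈ periodicSeqs p q := by
  rw [mem_periodicSeqs_iff]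
  intro i
  have : (p : ℝ) ≠ 0 := by exact_mod_cast hp.ne'
  push_cast
  field_simp
  ring

theorem isClosed_periodicSeqs (p q : ℤ) : IsClosed (periodicSeqs p q) := by
  have : periodicSeqs p q = ⋂ i : ℤ, {x : ℤ → ℝ | x (i + p) = x i + (q : ℝ)} := by
    ext x; simp [mem_periodicSeqs_iff]
  rw [this]
  exact isClosed_iInter fun i => isClosed_eq (by fun_prop) (by fun_prop)

/-- The summand `S(x_j, …, x_{j+r})` of the action. -/
def localAction (S : (Fin (r + 1) → ℝ) → ℝ) (x : ℤ → ℝ) (j : ℤ) : ℝ :=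
  S (fun i : Fin (r + 1) => x (j + ((i : ℕ) : ℤ)))

/-- The action of the block `[a, b)`. Half-open blocks, unlike those of `finiteAction`, can be
concatenated without correcting the end points. -/
def blockAction (S : (Fin (r + 1) → ℝ) → ℝ) (a b : ℤ) (x : ℤ → ℝ) : ℝ :=
  ∑ j ∈ Finset.Ico a b, localAction S x j

theorem periodicAction_eq_blockAction (p : ℤ) (x : ℤ → ℝ) :
    periodicAction S p x = blockAction S 0 p x := by
  have : Finset.Icc 0 (p - 1) = Finset.Ico 0 p := by ext; simp
  simp [periodicAction, finiteAction, blockAction, localAction, this]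

theorem blockAction_add {a b c : ℤ} (x : ℤ → ℝ) (hab : a ≤ b) (hbc : b ≤ c) :
    blockAction S a b x + blockAction S b c x = blockAction S a c x :=
  sum_Ico_add_sum_Ico _ hab hbc

theorem localAction_congr {x y : ℤ → ℝ} {j : ℤ} (h : ∀ i, j ≤ i → i ≤ j + r → x i = y i) :
    localAction S x j = localAction S y j := by
  unfold localAction
  congr 1
  ext i
  exact h _ (by omega) (by omega)

theorem continuous_localAction (hS : IsLocalPotential S) (j : ℤ) :
    Continuous fun x => localAction S x j :=
  hS.contDiff.continuous.comp (by fun_prop)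

theorem continuous_periodicAction (hS : IsLocalPotential S) (p : ℤ) :
    Continuous (periodicAction S p) := by
  have : periodicAction S p = fun x => blockAction S 0 p x :=
    funext fun x => periodicAction_eq_blockAction p x
  rw [this]
  exact continuous_finsetSum _ fun j _ => continuous_localAction hS j

theorem localAction_seqTranslate (hS : IsLocalPotential S) (k l : ℤ) (x : ℤ → ℝ) (j : ℤ) :
    localAction S (seqTranslate k l x) j = localAction S x (j - k) := by
  unfold localAction seqTranslate
  rw [hS.map_add_intCast l fun i : Fin (r + 1) => x (j + ((i : ℕ) : ℤ) - k)]
  congr 1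
  ext i
  congr 1
  ring

theorem localAction_add_period (hS : IsLocalPotential S) {p q : ℤ} {x : ℤ → ℝ}
    (hx : x ∈ periodicSeqs p q) (j : ℤ) : localAction S x (j + p) = localAction S x j := by
  have h := localAction_seqTranslate hS p q x (j + p)
  rw [show seqTranslate p q x = x from hx, add_sub_cancel_right] at h
  exact h

theorem blockAction_eq_periodicAction (hS : IsLocalPotential S) {p q : ℤ} (hp : 0 ≤ p) {x : ℤ → ℝ}
    (hx : x ∈ periodicSeqs p q) (a : ℤ) :
    blockAction S a (a + p) x = periodicAction S p x := by
  rw [periodicAction_eq_blockAction]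
  have := sum_Ico_of_periodic (localAction S x) hp (localAction_add_period hS hx) a 0
  rwa [zero_add] at this

theorem periodicAction_seqTranslate (hS : IsLocalPotential S) {p q : ℤ} (hp : 0 ≤ p) {x : ℤ → ℝ}
    (hx : x ∈ periodicSeqs p q) (k l : ℤ) :
    periodicAction S p (seqTranslate k l x) = periodicAction S p x := by
  rw [← blockAction_eq_periodicAction hS hp (seqTranslate_mem hx k l) k,
    ← blockAction_eq_periodicAction hS hp hx 0]
  unfold blockAction
  simp_rw [localAction_seqTranslate hS]
  have := sum_Ico_comp_add (fun j => localAction S x (j - k)) 0 p k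
  simp only [add_sub_cancel_right, zero_add] at this
  rw [zero_add, add_comm k p, this]

theorem periodicAction_inf_add_sup_le (hS : IsLocalPotential S) (p : ℤ) (x y : ℤ → ℝ) :
    periodicAction S p (x ⊓ y) + periodicAction S p (x ⊔ y)
      ≤ periodicAction S p x + periodicAction S p y := by
  simp only [periodicAction_eq_blockAction, blockAction]
  rw [← Finset.sum_add_distrib, ← Finset.sum_add_distrib]
  exact Finset.sum_le_sum fun j _ => hS.inf_add_sup_le _ _

theorem periodicAction_mul (hS : IsLocalPotential S) {p q : ℤ} (hp : 0 ≤ p) {x : ℤ → ℝ}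
    (hx : x ∈ periodicSeqs p q) (n : ℕ) :
    periodicAction S (n * p) x = n * periodicAction S p x := by
  induction n with
  | zero => simp [periodicAction_eq_blockAction, blockAction]
  | succ n ih =>
    have h0 : 0 ≤ (n : ℤ) * p := by positivity
    have h := blockAction_add (S := S) x h0 (show (n : ℤ) * p ≤ n * p + p by omega)
    rw [blockAction_eq_periodicAction hS hp hx, ← periodicAction_eq_blockAction, ih,
      ← periodicAction_eq_blockAction] at h
    push_cast
    rw [add_mul, one_mul, ← h]; ring

/-! ### Existence of minimizers -/

/-- Coercivity bounds the increments of a periodic sequence in terms of its action. -/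
theorem exists_increment_bound (hS : IsLocalPotential S) {p : ℤ} (hp : 0 < p) (q : ℤ) (c : ℝ) :
    ∃ B : ℝ, 0 ≤ B ∧ ∀ x ∈ periodicSeqs p q, periodicAction S p x ≤ c →
      ∀ i, |x (i + 1) - x i| ≤ B := by
  obtain ⟨b, hb⟩ := hS.bddBelow
  obtain ⟨k, hk⟩ := hS.coercive
  have hev := hk.eventually (eventually_gt_atTop (c - (p - 1) * b))
  rw [eventually_comap] at hev
  obtain ⟨B, hB⟩ := eventually_atTop.1 hev
  refine ⟨max B 0, le_max_right _ _, fun x hx hc i => ?_⟩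
  by_contra! hlt
  have h1 : c - (p - 1) * b < localAction S x (i - k) := by
    refine hB _ ((le_max_left B 0).trans hlt.le) _ ?_
    simp only [Fin.val_succ, Fin.val_castSucc]
    rw [show i - (k : ℤ) + ((k + 1 : ℕ) : ℤ) = i + 1 by push_cast; ring, sub_add_cancel]
  have h2 := blockAction_eq_periodicAction hS hp.le hx (i - k)
  rw [← blockAction_add (b := i - k + 1) x (by omega) (by omega)] at h2
  have h3 : blockAction S (i - k) (i - k + 1) x = localAction S x (i - k) := by
    have : Finset.Ico (i - (k : ℤ)) (i - k + 1) = {i - (k : ℤ)} := by ext; simp; omega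
    simp [blockAction, this]
  have h4 : (p - 1) * b ≤ blockAction S (i - k + 1) (i - k + p) x := by
    have := Finset.card_nsmul_le_sum (Finset.Ico (i - (k : ℤ) + 1) (i - k + p))
      (localAction S x) b fun j _ => hb ⟨_, rfl⟩
    rw [Int.card_Ico, nsmul_eq_mul] at this
    have e : (((i - k + p - (i - k + 1)).toNat : ℤ) : ℝ) = p - 1 := by
      rw [Int.toNat_of_nonneg (by omega)]; push_cast; ring
    rw [Int.cast_natCast] at e
    rwa [e] at this
  linarith

theorem isCompact_sublevel (hS : IsLocalPotential S) {p : ℤ} (hp : 0 < p) (q : ℤ) (a b c : ℝ) :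
    IsCompact {x | x ∈ periodicSeqs p q ∧ x 0 ∈ Set.Icc a b ∧ periodicAction S p x ≤ c} := by
  obtain ⟨B, hB0, hB⟩ := exists_increment_bound hS hp q c
  have hbox : IsCompact (Set.pi Set.univ
      fun i : ℤ => Set.Icc (a - |(i : ℝ)| * B) (b + |(i : ℝ)| * B)) :=
    isCompact_univ_pi fun _ => isCompact_Icc
  refine hbox.of_isClosed_subset ?_ ?_
  · refine (isClosed_periodicSeqs p q).inter (IsClosed.inter ?_ ?_)
    · exact isClosed_Icc.preimage (continuous_apply (0 : ℤ))
    · exact isClosed_le (continuous_periodicAction hS p) continuous_const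
  · rintro x ⟨hx, h0, hc⟩ i -
    have hinc := hB x hx hc
    have key : ∀ i : ℤ, |x i - x 0| ≤ |(i : ℝ)| * B := by
      intro i
      induction i using Int.induction_on with
      | zero => simp
      | succ n ih =>
        have h1 := hinc n
        have h2 := abs_sub_le (x (n + 1)) (x n) (x 0)
        have e : |((n + 1 : ℤ) : ℝ)| = n + 1 := by
          rw [abs_of_nonneg (by positivity)]; push_cast; ring
        have e' : |((n : ℤ) : ℝ)| = n := by simp
        rw [e]; rw [e'] at ih
        linarith
      | pred n ih =>
        have h1 := hinc (-(n : ℤ) - 1)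
        rw [sub_add_cancel, abs_sub_comm] at h1
        have h2 := abs_sub_le (x (-(n : ℤ) - 1)) (x (-n)) (x 0)
        have e : |((-(n : ℤ) - 1 : ℤ) : ℝ)| = n + 1 := by
          rw [abs_of_nonpos (by push_cast; linarith [(Nat.cast_nonneg n : (0 : ℝ) ≤ n)])]
          push_cast; ring
        have e' : |((-(n : ℤ) : ℤ) : ℝ)| = n := by simp
        rw [e]; rw [e'] at ih
        linarith
    have := abs_le.1 (key i)
    constructor <;> linarith [this.1, this.2, h0.1, h0.2]

theorem exists_isMinOn_of_isClosed (hS : IsLocalPotential S) {p q : ℤ} (hp : 0 < p)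
    {A : Set (ℤ → ℝ)} (hA : IsClosed A) (hne : A.Nonempty) {a b : ℝ}
    (hsub : ∀ x ∈ A, x ∈ periodicSeqs p q ∧ x 0 ∈ Set.Icc a b) :
    ∃ x ∈ A, IsMinOn (periodicAction S p) A x := by
  obtain ⟨y, hy⟩ := hne
  have hc : IsCompact (A ∩ {x | periodicAction S p x ≤ periodicAction S p y}) := by
    refine (isCompact_sublevel hS hp q a b (periodicAction S p y)).of_isClosed_subset
      (hA.inter (isClosed_le (continuous_periodicAction hS p) continuous_const)) ?_
    rintro x ⟨hx, hxy⟩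
    exact ⟨(hsub x hx).1, (hsub x hx).2, hxy⟩
  obtain ⟨x, hx, hmin⟩ := hc.exists_isMinOn ⟨y, hy, le_refl (periodicAction S p y)⟩
    (continuous_periodicAction hS p).continuousOn
  refine ⟨x, hx.1, fun z hz => ?_⟩
  rcases le_total (periodicAction S p z) (periodicAction S p y) with h | h
  · exact hmin ⟨hz, h⟩
  · exact le_trans hx.2 h

theorem exists_pinned_minimizer (hS : IsLocalPotential S) {p : ℤ} (hp : 0 < p) (q : ℤ) (ξ : ℝ) :
    ∃ x ∈ pinnedPeriodicSeqs p q ξ,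
      IsMinOn (periodicAction S p) (pinnedPeriodicSeqs p q ξ) x := by
  refine exists_isMinOn_of_isClosed (a := ξ) (b := ξ) hS hp ?_ ?_ fun x hx => ⟨hx.1, ?_⟩
  · exact (isClosed_periodicSeqs p q).inter
      (isClosed_eq (continuous_apply (0 : ℤ)) continuous_const)
  · exact ⟨_, linear_mem_periodicSeqs hp ξ, by simp⟩
  · simp [hx.2]

theorem exists_int_translate {p q : ℤ} {x : ℤ → ℝ} (hx : x ∈ periodicSeqs p q) :
    ∃ l : ℤ, seqTranslate 0 l x ∈ periodicSeqs p q ∧ seqTranslate 0 l x 0 ∈ Set.Icc (0 : ℝ) 1 := by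
  refine ⟨-⌊x 0⌋, seqTranslate_mem hx _ _, ?_⟩
  have h2 := Int.floor_le (x 0)
  have h3 := Int.lt_floor_add_one (x 0)
  simp only [seqTranslate, sub_self, Int.cast_neg, Set.mem_Icc]
  constructor <;> linarith

theorem exists_minimizer (hS : IsLocalPotential S) {p : ℤ} (hp : 0 < p) (q : ℤ) :
    ∃ x ∈ periodicSeqs p q, IsMinOn (periodicAction S p) (periodicSeqs p q) x := by
  obtain ⟨x, hx, hmin⟩ := exists_isMinOn_of_isClosed (q := q) (a := 0) (b := 1)
    (A := periodicSeqs p q ∩ {x | x 0 ∈ Set.Icc (0 : ℝ) 1}) hS hp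
    ((isClosed_periodicSeqs p q).inter (isClosed_Icc.preimage (continuous_apply (0 : ℤ))))
    ⟨_, linear_mem_periodicSeqs hp 0, by simp⟩ fun x hx => hx
  refine ⟨x, hx.1, fun z hz => ?_⟩
  obtain ⟨l, hl, hl'⟩ := exists_int_translate hz
  have := hmin ⟨hl, hl'⟩
  simp only [Set.mem_ofPred_eq] at this ⊢
  rwa [periodicAction_seqTranslate hS hp.le hz] at this

/-- The minimal action of `(p,q)`-periodic sequences. -/
def minAction (S : (Fin (r + 1) → ℝ) → ℝ) (p q : ℤ) : ℝ :=
  sInf (periodicAction S p '' periodicSeqs p q)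

/-- The minimal action of `(p,q)`-periodic sequences through `ξ`. -/
def pinnedMinAction (S : (Fin (r + 1) → ℝ) → ℝ) (p q : ℤ) (ξ : ℝ) : ℝ :=
  sInf (periodicAction S p '' pinnedPeriodicSeqs p q ξ)

theorem sInf_image_eq_of_isMinOn {α : Type*} {f : α → ℝ} {A : Set α} {x : α} (hx : x ∈ A)
    (h : IsMinOn f A x) : sInf (f '' A) = f x :=
  IsLeast.csInf_eq ⟨⟨x, hx, rfl⟩, by rintro _ ⟨y, hy, rfl⟩; exact h hy⟩

theorem exists_eq_minAction (hS : IsLocalPotential S) {p : ℤ} (hp : 0 < p) (q : ℤ) :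
    ∃ x ∈ periodicSeqs p q, periodicAction S p x = minAction S p q := by
  obtain ⟨x, hx, hmin⟩ := exists_minimizer hS hp q
  exact ⟨x, hx, (sInf_image_eq_of_isMinOn hx hmin).symm⟩

theorem minAction_le (hS : IsLocalPotential S) {p q : ℤ} (hp : 0 < p) {x : ℤ → ℝ}
    (hx : x ∈ periodicSeqs p q) : minAction S p q ≤ periodicAction S p x := by
  obtain ⟨y, hy, hmin⟩ := exists_minimizer hS hp q
  rw [minAction, sInf_image_eq_of_isMinOn hy hmin]
  exact hmin hx

theorem exists_eq_pinnedMinAction (hS : IsLocalPotential S) {p : ℤ} (hp : 0 < p) (q : ℤ) (ξ : ℝ) :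
    ∃ x ∈ periodicSeqs p q, x 0 = ξ ∧ periodicAction S p x = pinnedMinAction S p q ξ := by
  obtain ⟨x, hx, hmin⟩ := exists_pinned_minimizer hS hp q ξ
  exact ⟨x, hx.1, hx.2, (sInf_image_eq_of_isMinOn hx hmin).symm⟩

theorem pinnedMinAction_le (hS : IsLocalPotential S) {p q : ℤ} (hp : 0 < p) {x : ℤ → ℝ}
    (hx : x ∈ periodicSeqs p q) : pinnedMinAction S p q (x 0) ≤ periodicAction S p x := by
  obtain ⟨y, hy, hmin⟩ := exists_pinned_minimizer hS hp q (x 0)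
  rw [pinnedMinAction, sInf_image_eq_of_isMinOn hy hmin]
  exact hmin ⟨hx, rfl⟩

theorem minAction_le_pinnedMinAction (hS : IsLocalPotential S) {p : ℤ} (hp : 0 < p) (q : ℤ)
    (ξ : ℝ) : minAction S p q ≤ pinnedMinAction S p q ξ := by
  obtain ⟨x, hx, -, h⟩ := exists_eq_pinnedMinAction hS hp q ξ
  exact h ▸ minAction_le hS hp hx

/-! ### Well-ordered minimizers -/

/-- A strictly submodular functional on `(p,q)`-periodic sequences in which every pair of sites of
a period interacts. -/
def pairEnergy (p : ℤ) (x : ℤ → ℝ) : ℝ :=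
  ∑ i ∈ Finset.Ico 0 p, ∑ k ∈ Finset.Ico 0 p, (x i - x (i + k)) ^ 2

theorem continuous_pairEnergy (p : ℤ) : Continuous (pairEnergy p) := by
  unfold pairEnergy; fun_prop

theorem pairEnergy_seqTranslate {p q : ℤ} (hp : 0 ≤ p) {x : ℤ → ℝ}
    (hx : x ∈ periodicSeqs p q) (k l : ℤ) :
    pairEnergy p (seqTranslate k l x) = pairEnergy p x := by
  unfold pairEnergy seqTranslate
  set f : ℤ → ℝ := fun i => ∑ j ∈ Finset.Ico 0 p, (x i - x (i + j)) ^ 2 with hf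
  have hper : ∀ i, f (i + p) = f i := fun i => by
    refine Finset.sum_congr rfl fun j _ => ?_
    rw [mem_periodicSeqs_iff] at hx
    rw [show i + p + j = i + j + p by ring, hx, hx]
    ring
  have h1 := sum_Ico_comp_add f 0 p (-k)
  have h2 := sum_Ico_of_periodic f hp hper (-k) 0
  rw [zero_add, add_comm p, h2, zero_add] at h1
  rw [← h1]
  refine Finset.sum_congr rfl fun i _ => Finset.sum_congr rfl fun j _ => ?_
  rw [show i + j - k = i + -k + j by ring, ← sub_eq_add_neg]
  ring

theorem sq_inf_add_sq_sup (a b c d : ℝ) :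
    (a ⊓ b - c ⊓ d) ^ 2 + (a ⊔ b - c ⊔ d) ^ 2 ≤ (a - c) ^ 2 + (b - d) ^ 2 := by
  rcases le_total a b with h | h <;> rcases le_total c d with h' | h' <;>
    simp only [inf_of_le_left, inf_of_le_right, sup_of_le_left, sup_of_le_right, h, h'] <;>
    nlinarith [mul_nonneg (sub_nonneg.2 h) (sub_nonneg.2 h')]

theorem sq_inf_add_sq_sup_lt {a b c d : ℝ} (h : a < b) (h' : d < c) :
    (a ⊓ b - c ⊓ d) ^ 2 + (a ⊔ b - c ⊔ d) ^ 2 < (a - c) ^ 2 + (b - d) ^ 2 := by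
  simp only [inf_of_le_left, inf_of_le_right, sup_of_le_left, sup_of_le_right, h.le, h'.le]
  nlinarith [mul_pos (sub_pos.2 h) (sub_pos.2 h')]

theorem exists_mem_Ico_add_mul {p : ℤ} (hp : 0 < p) (a i : ℤ) :
    ∃ n : ℤ, i + n * p ∈ Finset.Ico a (a + p) := by
  refine ⟨-((i - a) / p), ?_⟩
  have h1 := Int.emod_add_mul_ediv (i - a) p
  have h2 := Int.emod_nonneg (i - a) hp.ne'
  have h3 := Int.emod_lt_of_pos (i - a) hp
  have : i + -((i - a) / p) * p = a + (i - a) % p := by linarith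
  rw [this, Finset.mem_Ico]
  omega

/-- Sequences that cross somewhere lose pair energy when replaced by their minimum and maximum. -/
theorem le_or_le_of_pairEnergy {p q : ℤ} (hp : 0 < p) {x y : ℤ → ℝ} (hx : x ∈ periodicSeqs p q)
    (hy : y ∈ periodicSeqs p q)
    (h : pairEnergy p x + pairEnergy p y ≤ pairEnergy p (x ⊓ y) + pairEnergy p (x ⊔ y)) :
    x ≤ y ∨ y ≤ x := by
  by_contra hcon
  simp only [not_or, Pi.le_def, not_forall, not_le] at hcon
  obtain ⟨⟨j, hj⟩, ⟨i, hi⟩⟩ := hcon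
  obtain ⟨n, hn⟩ := exists_mem_Ico_add_mul hp 0 i
  obtain ⟨m, hm⟩ := exists_mem_Ico_add_mul hp (i + n * p) j
  rw [zero_add] at hn
  have hi' : x (i + n * p) < y (i + n * p) := by
    rw [periodicSeqs_mul hx, periodicSeqs_mul hy]; linarith
  have hj' : y (j + m * p) < x (j + m * p) := by
    rw [periodicSeqs_mul hx, periodicSeqs_mul hy]; linarith
  refine h.not_gt ?_
  simp only [pairEnergy, ← Finset.sum_add_distrib]
  refine Finset.sum_lt_sum (fun s _ => Finset.sum_le_sum fun t _ => sq_inf_add_sq_sup _ _ _ _)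
    ⟨i + n * p, hn, ?_⟩
  refine Finset.sum_lt_sum (fun t _ => sq_inf_add_sq_sup _ _ _ _)
    ⟨j + m * p - (i + n * p), ?_, ?_⟩
  · rw [Finset.mem_Ico] at hm ⊢; omega
  · rw [add_sub_cancel]
    exact sq_inf_add_sq_sup_lt hi' hj'

/-- Among the minimizers of the action, which form a lattice, one of least pair energy is
comparable to all its translates. -/
theorem exists_comparable_minimizer (hS : IsLocalPotential S) {p : ℤ} (hp : 0 < p) (q : ℤ) :
    ∃ y ∈ periodicSeqs p q, periodicAction S p y = minAction S p q ∧
      ∀ k l : ℤ, seqTranslate k l y ≤ y ∨ y ≤ seqTranslate k l y := by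
  have hcomp := isCompact_sublevel hS hp q 0 1 (minAction S p q)
  have hne : {x | x ∈ periodicSeqs p q ∧ x 0 ∈ Set.Icc (0 : ℝ) 1 ∧
      periodicAction S p x ≤ minAction S p q}.Nonempty := by
    obtain ⟨x, hx, hxm⟩ := exists_eq_minAction hS hp q
    obtain ⟨l, hl, hl'⟩ := exists_int_translate hx
    exact ⟨_, hl, hl', by rw [periodicAction_seqTranslate hS hp.le hx, hxm]⟩
  obtain ⟨y, ⟨hy, -, hym⟩, hmin⟩ := hcomp.exists_isMinOn hne (continuous_pairEnergy p).continuousOn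
  have hmin' : ∀ z ∈ periodicSeqs p q, periodicAction S p z ≤ minAction S p q →
      pairEnergy p y ≤ pairEnergy p z := by
    intro z hz hzm
    obtain ⟨l, hl, hl'⟩ := exists_int_translate hz
    rw [← pairEnergy_seqTranslate hp.le hz 0 l]
    exact hmin ⟨hl, hl', by rwa [periodicAction_seqTranslate hS hp.le hz]⟩
  refine ⟨y, hy, le_antisymm hym (minAction_le hS hp hy), fun k l => ?_⟩
  have hτ := seqTranslate_mem hy k l
  have hτa := periodicAction_seqTranslate hS hp.le hy k l
  have hsub := periodicAction_inf_add_sup_le hS p (seqTranslate k l y) y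
  have h1 := minAction_le hS hp (inf_mem_periodicSeqs hτ hy)
  have h2 := minAction_le hS hp (sup_mem_periodicSeqs hτ hy)
  refine le_or_le_of_pairEnergy hp hτ hy ?_
  rw [pairEnergy_seqTranslate hp.le hy]
  exact add_le_add (hmin' _ (inf_mem_periodicSeqs hτ hy) (by linarith))
    (hmin' _ (sup_mem_periodicSeqs hτ hy) (by linarith))

/-- `y` is ordered like the sequence `i ↦ i * Ω`: a translate that lies above `y` in terms of
the rotation number `Ω` lies above `y`. -/
def WellOrdered (Ω : ℝ) (y : ℤ → ℝ) : Prop :=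
  ∀ i k l : ℤ, (k : ℝ) * Ω ≤ l → y (i + k) ≤ y i + l

theorem wellOrdered_of_comparable {p q : ℤ} (hp : 0 < p) {y : ℤ → ℝ} (hy : y ∈ periodicSeqs p q)
    (h : ∀ k l : ℤ, seqTranslate k l y ≤ y ∨ y ≤ seqTranslate k l y) :
    WellOrdered ((q : ℝ) / p) y := by
  intro i k l hkl
  have hp' : (0 : ℝ) < p := by exact_mod_cast hp
  rw [← mul_div_assoc, div_le_iff₀ hp'] at hkl
  rcases h k l with h | h
  · have hstep : ∀ i, y i + l ≤ y (i + k) := fun i => by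
      have := h (i + k)
      simpa [seqTranslate] using this
    have hiter : ∀ (n : ℕ) (i : ℤ), y i + n * l ≤ y (i + n * k) := by
      intro n
      induction n with
      | zero => simp
      | succ n ih =>
        intro i
        have h1 := ih i
        have h2 := hstep (i + n * k)
        rw [show i + (n : ℤ) * k + k = i + ((n + 1 : ℕ) : ℤ) * k by push_cast; ring] at h2
        push_cast at h2 ⊢
        linarith
    -- `p` steps amount to a shift by `(k * p, k * q)`, under which `y` is periodic.
    have h1 := hiter (p - 1).toNat (i + k)
    have e : (((p - 1).toNat : ℕ) : ℤ) = p - 1 := Int.toNat_of_nonneg (by omega)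
    have e' : (((p - 1).toNat : ℕ) : ℝ) = p - 1 := by
      rw [← Int.cast_natCast, e]; push_cast; ring
    rw [e, e', show i + k + (p - 1) * k = i + k * p by ring, periodicSeqs_mul hy] at h1
    linarith
  · have := h (i + k)
    simpa [seqTranslate] using this

theorem exists_wellOrdered_minimizer (hS : IsLocalPotential S) {p : ℤ} (hp : 0 < p) (q : ℤ) :
    ∃ y ∈ periodicSeqs p q, periodicAction S p y = minAction S p q ∧
      WellOrdered ((q : ℝ) / p) y := by
  obtain ⟨y, hy, hm, hc⟩ := exists_comparable_minimizer hS hp q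
  exact ⟨y, hy, hm, wellOrdered_of_comparable hp hy hc⟩

/-- Over `c` steps to the left, a window sum of length `p` drops by at least `c * q` if `y` gains
at least `q` over each `p` sites. -/
theorem sum_Ico_sub_le {y : ℤ → ℝ} {p q : ℤ} (hp : 0 ≤ p) (h : ∀ t, y t + q ≤ y (t + p)) (a : ℤ)
    (c : ℕ) :
    ∑ t ∈ Finset.Ico a (a + p), y (t - c) ≤ ∑ t ∈ Finset.Ico a (a + p), y t - c * q := by
  have e : ∀ c : ℕ, ∑ t ∈ Finset.Ico a (a + p), y (t - c)
      = ∑ t ∈ Finset.Ico (a - c) (a - c + p), y t := fun c => by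
    have := sum_Ico_comp_add y a (a + p) (-(c : ℤ))
    simp only [← sub_eq_add_neg] at this
    rw [this]; congr 2; ring
  rw [e]
  induction c with
  | zero => simp
  | succ c ih =>
    have h1 := sum_Ico_shift y (a - (c + 1 : ℕ)) hp
    have h2 := h (a - (c + 1 : ℕ))
    rw [show a - ((c + 1 : ℕ) : ℤ) + 1 = a - c by push_cast; ring] at h1
    push_cast at h1 h2 ih ⊢
    linarith

theorem exists_mul_sub_mul_eq {p q : ℤ} (hp : 0 < p) (hpq : IsCoprime p q) (N : ℤ) :
    ∃ b c : ℤ, 0 ≤ c ∧ c < p ∧ p * b - c * q = N := by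
  obtain ⟨u, v, huv⟩ := hpq
  refine ⟨u * N - q * (-(v * N) / p), -(v * N) % p, Int.emod_nonneg _ hp.ne',
    Int.emod_lt_of_pos _ hp, ?_⟩
  have := Int.emod_add_mul_ediv (-(v * N)) p
  linear_combination N * huv - q * this

namespace WellOrdered

variable {Ω : ℝ} {y : ℤ → ℝ}

theorem ge (h : WellOrdered Ω y) (i k l : ℤ) (hkl : (l : ℝ) ≤ k * Ω) : y i + l ≤ y (i + k) := by
  have := h (i + k) (-k) (-l) (by push_cast; linarith)
  rw [add_neg_cancel_right] at this
  push_cast at this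
  linarith

theorem abs_sub_le (h : WellOrdered Ω y) (i k : ℤ) : |y (i + k) - y i - k * Ω| ≤ 1 := by
  have h1 := h i k ⌈(k : ℝ) * Ω⌉ (Int.le_ceil _)
  have h2 := h.ge i k ⌊(k : ℝ) * Ω⌋ (Int.floor_le _)
  have h3 := Int.ceil_lt_add_one ((k : ℝ) * Ω)
  have h4 := Int.lt_floor_add_one ((k : ℝ) * Ω)
  rw [abs_le]
  constructor <;> linarith

theorem seqTranslate (h : WellOrdered Ω y) (k l : ℤ) : WellOrdered Ω (seqTranslate k l y) := by
  intro i k' l' hkl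
  have := h (i - k) k' l' hkl
  simp only [_root_.seqTranslate]
  rw [show i + k' - k = i - k + k' by ring]
  linarith

theorem neg (h : WellOrdered Ω y) : WellOrdered (-Ω) (-y) := by
  intro i k l hkl
  have := h.ge i k (-l) (by push_cast; linarith)
  push_cast at this
  simp only [Pi.neg_apply]
  linarith

theorem sum_gap_le_of_le (h : WellOrdered Ω y) {p q : ℤ} (hp : 0 < p) (hpq : IsCoprime p q)
    (hd : (q : ℝ) ≤ p * Ω) (a : ℤ) :
    ∑ t ∈ Finset.Ico a (a + p), |y (t + p) - q - y t| ≤ 2 * p * (p * Ω - q) + 1 := by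
  have hp' : (0 : ℝ) < p := by exact_mod_cast hp
  set N : ℤ := ⌈2 * p * (p * Ω - q)⌉ with hN
  -- the translate `τ_{c,b}` moves by `N / p` in terms of the rotation number `q / p`
  obtain ⟨b, c, hc0, hcp, hbc⟩ := exists_mul_sub_mul_eq hp hpq N
  have hbc' : (p : ℝ) * b - c * q = N := by exact_mod_cast hbc
  have hc0' : (0 : ℝ) ≤ c := by exact_mod_cast hc0
  have hcp' : (c : ℝ) ≤ p := by exact_mod_cast hcp.le
  have hNle : 2 * p * (p * Ω - q) ≤ (N : ℝ) := Int.le_ceil _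
  have hNlt : (N : ℝ) < 2 * p * (p * Ω - q) + 1 := Int.ceil_lt_add_one _
  have hge : ∀ t, y t + q ≤ y (t + p) := fun t => h.ge t p q hd
  -- it moves farther than `τ_{-p,-q}`, even in terms of the rotation number `Ω`
  have hle : ∀ t, y (t + p) ≤ y (t - c) + (b + q) := fun t => by
    have := h (t - c) (c + p) (b + q) (by
      push_cast
      have h1 : 0 ≤ (p - c : ℝ) * (p * Ω - q) := mul_nonneg (by linarith) (by linarith)
      refine le_of_mul_le_mul_left ?_ hp'
      nlinarith)
    rw [show t - c + (c + p) = t + p by ring] at this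
    push_cast at this
    exact this
  have hsum := sum_Ico_sub_le hp.le hge a c.toNat
  have e : ((c.toNat : ℕ) : ℤ) = c := Int.toNat_of_nonneg hc0
  have e' : ((c.toNat : ℕ) : ℝ) = c := by rw [← Int.cast_natCast, e]
  rw [e, e'] at hsum
  calc ∑ t ∈ Finset.Ico a (a + p), |y (t + p) - q - y t|
      ≤ ∑ t ∈ Finset.Ico a (a + p), (y (t - c) + b - y t) := by
        refine Finset.sum_le_sum fun t _ => ?_
        rw [abs_of_nonneg (by linarith [hge t])]
        linarith [hle t]
    _ = ∑ t ∈ Finset.Ico a (a + p), y (t - c) + p * b - ∑ t ∈ Finset.Ico a (a + p), y t := by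
        rw [Finset.sum_sub_distrib, Finset.sum_add_distrib, Finset.sum_const, Int.card_Ico,
          nsmul_eq_mul, add_sub_cancel_left, ← Int.cast_natCast, Int.toNat_of_nonneg hp.le]
    _ ≤ 2 * p * (p * Ω - q) + 1 := by linarith

/-- Total distance between a well-ordered `y` and its translate `τ_{-p,-q} y` over `p`
consecutive sites. The bound has no term growing with the period of `y`. The translate is compared
with `τ_{c,b} y`, `p b - c q = ⌈2p|pΩ - q|⌉`, whose distance to `y` telescopes. -/
theorem sum_gap_le (h : WellOrdered Ω y) {p q : ℤ} (hp : 0 < p) (hpq : IsCoprime p q) (a : ℤ) :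
    ∑ t ∈ Finset.Ico a (a + p), |y (t + p) - q - y t| ≤ 2 * p * |p * Ω - q| + 1 := by
  rcases le_total (q : ℝ) (p * Ω) with hd | hd
  · rw [abs_of_nonneg (by linarith)]
    exact h.sum_gap_le_of_le hp hpq hd a
  · have := h.neg.sum_gap_le_of_le hp hpq.neg_right (by push_cast; linarith) a
    rw [abs_of_nonpos (by linarith)]
    convert this using 1
    · refine Finset.sum_congr rfl fun t _ => ?_
      rw [← abs_neg]
      congr 1
      simp only [Pi.neg_apply]; push_cast; ring
    · push_cast; ring

end WellOrdered

/-- Two consecutive translates of a well-ordered minimizer that enclose `ξ` at the site `0`. The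
translates fill the circle, so that consecutive ones have total distance `1` over a period. -/
theorem exists_bracket (hS : IsLocalPotential S) {p q : ℤ} (hp : 0 < p) (hpq : IsCoprime p q)
    (ξ : ℝ) :
    ∃ y ∈ periodicSeqs p q, ∃ z ∈ periodicSeqs p q,
      periodicAction S p y = minAction S p q ∧ periodicAction S p z = minAction S p q ∧
      WellOrdered ((q : ℝ) / p) y ∧ WellOrdered ((q : ℝ) / p) z ∧ y ≤ z ∧ y 0 ≤ ξ ∧ ξ ≤ z 0 ∧
      ∀ a, ∑ t ∈ Finset.Ico a (a + p), (z t - y t) ≤ 1 := by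
  have hp' : (0 : ℝ) < p := by exact_mod_cast hp
  obtain ⟨u, hu, hum, huw⟩ := exists_wellOrdered_minimizer hS hp q
  obtain ⟨l, k, hk, -, hkl⟩ := exists_mul_sub_mul_eq hp hpq 1
  have hkl' : (p : ℝ) * l - k * q = 1 := by exact_mod_cast hkl
  have hest : ∀ m : ℤ, |seqTranslate (m * k) (m * l) u 0 - u 0 - m / p| ≤ 1 := fun m => by
    have := huw.abs_sub_le 0 (-(m * k))
    convert this using 2
    simp only [seqTranslate]
    rw [zero_sub, zero_add]
    push_cast
    field_simp
    linear_combination m * hkl'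
  obtain ⟨m, hm, hmax⟩ : ∃ m : ℤ, seqTranslate (m * k) (m * l) u 0 ≤ ξ ∧
      ∀ n : ℤ, seqTranslate (n * k) (n * l) u 0 ≤ ξ → n ≤ m := by
    refine Int.exists_greatest_of_bdd ⟨⌈p * (ξ - u 0 + 1)⌉, fun n hn => ?_⟩
      ⟨⌊p * (ξ - u 0 - 1)⌋, ?_⟩
    · have h1 := (abs_le.1 (hest n)).1
      have h2 : (n : ℝ) / p ≤ ξ - u 0 + 1 := by linarith
      rw [div_le_iff₀ hp'] at h2
      have h3 := Int.le_ceil (p * (ξ - u 0 + 1))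
      have : (n : ℝ) ≤ (⌈p * (ξ - u 0 + 1)⌉ : ℤ) := by linarith
      exact_mod_cast this
    · have h1 := (abs_le.1 (hest ⌊p * (ξ - u 0 - 1)⌋)).2
      have h3 := Int.floor_le (p * (ξ - u 0 - 1))
      have h2 : ((⌊p * (ξ - u 0 - 1)⌋ : ℤ) : ℝ) / p ≤ ξ - u 0 - 1 := by
        rw [div_le_iff₀ hp']; linarith
      linarith
  have hz0 : ξ ≤ seqTranslate ((m + 1) * k) ((m + 1) * l) u 0 := by
    by_contra! hlt
    have := hmax _ hlt.le
    omega
  refine ⟨seqTranslate (m * k) (m * l) u, seqTranslate_mem hu _ _,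
    seqTranslate ((m + 1) * k) ((m + 1) * l) u, seqTranslate_mem hu _ _,
    by rw [periodicAction_seqTranslate hS hp.le hu, hum],
    by rw [periodicAction_seqTranslate hS hp.le hu, hum],
    huw.seqTranslate _ _, huw.seqTranslate _ _, fun i => ?_, hm, hz0, fun a => ?_⟩
  · have := huw.ge (i - m * k) (-k) (-l) (by
      push_cast
      rw [← mul_div_assoc, le_div_iff₀ hp']
      linarith)
    simp only [seqTranslate]
    rw [show i - (m + 1) * k = i - m * k + -k by ring]
    push_cast at this ⊢
    linarith
  · set v := seqTranslate (m * k) (m * l) u with hv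
    have hvm : v ∈ periodicSeqs p q := seqTranslate_mem hu _ _
    rw [mem_periodicSeqs_iff] at hvm
    have hsum := sum_Ico_sub_le hp.le (fun t => (hvm t).ge) a k.toNat
    have e : ((k.toNat : ℕ) : ℤ) = k := Int.toNat_of_nonneg hk
    have e' : ((k.toNat : ℕ) : ℝ) = k := by rw [← Int.cast_natCast, e]
    rw [e, e'] at hsum
    have hzv : ∀ t, seqTranslate ((m + 1) * k) ((m + 1) * l) u t - v t = v (t - k) + l - v t :=
      fun t => by
        simp only [hv, seqTranslate]
        rw [show t - (m + 1) * k = t - k - m * k by ring]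
        push_cast; ring
    simp_rw [hzv]
    rw [Finset.sum_sub_distrib, Finset.sum_add_distrib, Finset.sum_const, Int.card_Ico,
      nsmul_eq_mul, add_sub_cancel_left, ← Int.cast_natCast, Int.toNat_of_nonneg hp.le]
    linarith

/-! ### Cutting and closing up sequences -/

/-- `K` is a Lipschitz constant of `S` for the sup norm on configurations of oscillation at most
`M`. -/
def LipschitzOnOscillation (S : (Fin (r + 1) → ℝ) → ℝ) (M K : ℝ) : Prop :=
  0 < K ∧ ∀ u w : Fin (r + 1) → ℝ, (∀ i, |u i - u 0| ≤ M) → (∀ i, |w i - w 0| ≤ M) →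
    ∀ E : ℝ, (∀ i, |u i - w i| ≤ E) → |S u - S w| ≤ K * E

/-- The oscillation of `x` to the right of any site, over distances at most `r`, is at most `M`. -/
def OscillationLE (r : ℕ) (M : ℝ) (x : ℤ → ℝ) : Prop :=
  ∀ j i : ℤ, 0 ≤ i → i ≤ r → |x (j + i) - x j| ≤ M

theorem OscillationLE.mono {M N : ℝ} {x : ℤ → ℝ} (h : OscillationLE r M x) (hMN : M ≤ N) :
    OscillationLE r N x := fun j i h0 h1 => (h j i h0 h1).trans hMN

theorem WellOrdered.oscillationLE {Ω L : ℝ} {y : ℤ → ℝ} (h : WellOrdered Ω y) (hL : |Ω| ≤ L)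
    (r : ℕ) : OscillationLE r (r * L + 1) y := by
  intro j i h0 h1
  have hi : |(i : ℝ)| ≤ r := by
    rw [abs_of_nonneg (by exact_mod_cast h0)]; exact_mod_cast h1
  have h2 := h.abs_sub_le j i
  have h3 : |(i : ℝ) * Ω| ≤ r * L := by
    rw [abs_mul]; gcongr
  have h4 := abs_add_le (y (j + i) - y j - i * Ω) (i * Ω)
  rw [sub_add_cancel] at h4
  linarith

theorem OscillationLE.of_mem_Icc {M c : ℝ} {x y z : ℤ → ℝ} (h : OscillationLE r M y)
    (hyx : y ≤ x) (hxz : x ≤ z) (hyz : ∀ j, z j ≤ y j + c) : OscillationLE r (M + c) x := by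
  intro j i h0 h1
  have h2 := abs_le.1 (h j i h0 h1)
  have a1 := hyx j
  have a2 := hyx (j + i)
  have a3 := (hxz j).trans (hyz j)
  have a4 := (hxz (j + i)).trans (hyz (j + i))
  rw [abs_le]
  constructor <;> linarith [h2.1, h2.2]

/-- The action of a block depends on the `r` sites following it in a Lipschitz way. -/
theorem abs_blockAction_sub_le {M E₀ K E : ℝ} (hK : LipschitzOnOscillation S (M + E₀) K)
    (hE : 0 ≤ E) (hE₀ : E ≤ E₀) {x z : ℤ → ℝ} (hx : OscillationLE r M x) {a b : ℤ}
    (hzx : ∀ j, a ≤ j → j < b → z j = x j)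
    (hzE : ∀ j, b ≤ j → j < b + r → |z j - x j| ≤ E) :
    |blockAction S a b z - blockAction S a b x| ≤ r * (K * E) := by
  unfold blockAction
  rw [← Finset.sum_sub_distrib]
  refine (Finset.abs_sum_le_sum_abs _ _).trans ?_
  refine sum_Ico_le_mul (mul_nonneg hK.1.le hE) (fun j hj hjb => ?_) fun j hj => ?_
  · rw [Finset.mem_Ico] at hj
    rw [localAction_congr fun i h1 h2 => hzx i (by omega) (by omega), sub_self, abs_zero]
  · rw [Finset.mem_Ico] at hj
    have hclose : ∀ i : Fin (r + 1), |z (j + ((i : ℕ) : ℤ)) - x (j + ((i : ℕ) : ℤ))| ≤ E := by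
      intro i
      by_cases h : j + ((i : ℕ) : ℤ) < b
      · rw [hzx _ (by omega) h, sub_self, abs_zero]; exact hE
      · exact hzE _ (by omega) (by omega)
    have hosc : ∀ i : Fin (r + 1), |x (j + ((i : ℕ) : ℤ)) - x j| ≤ M := fun i =>
      hx j _ (by omega) (by omega)
    refine hK.2 _ _ (fun i => ?_) (fun i => ?_) E hclose
    · have h0 := hzx j hj.1 hj.2
      simp only [Fin.val_zero, Nat.cast_zero, add_zero, h0]
      have := abs_sub_le (z (j + ((i : ℕ) : ℤ))) (x (j + ((i : ℕ) : ℤ))) (x j)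
      linarith [hclose i, hosc i]
    · simp only [Fin.val_zero, Nat.cast_zero, add_zero]
      linarith [hosc i]

/-- The `(n,q)`-periodic sequence that agrees with `x` on `[a, a + n)`. -/
def closeUp (x : ℤ → ℝ) (a n q : ℤ) : ℤ → ℝ :=
  fun j => x (a + (j - a) % n) + (((j - a) / n : ℤ) : ℝ) * q

theorem closeUp_mem {n : ℤ} (hn : 0 < n) (x : ℤ → ℝ) (a q : ℤ) :
    closeUp x a n q ∈ periodicSeqs n q := by
  rw [mem_periodicSeqs_iff]
  intro i
  unfold closeUp
  rw [show i + n - a = i - a + n by ring, Int.add_emod_right,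
    Int.add_ediv_of_dvd_right (dvd_refl n), Int.ediv_self hn.ne']
  push_cast; ring

theorem closeUp_of_mem (x : ℤ → ℝ) (a n q : ℤ) {j : ℤ} (h0 : a ≤ j) (h1 : j < a + n) :
    closeUp x a n q j = x j := by
  unfold closeUp
  rw [Int.emod_eq_of_lt (by omega) (by omega), Int.ediv_eq_zero_of_lt (by omega) (by omega)]
  simp

theorem closeUp_mono {x y : ℤ → ℝ} (h : x ≤ y) (a n q : ℤ) :
    closeUp x a n q ≤ closeUp y a n q := fun j => by
  unfold closeUp
  linarith [h (a + (j - a) % n)]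

theorem abs_closeUp_sub_le_sum {n : ℤ} (hn : 0 < n) (x : ℤ → ℝ) (a q : ℤ) (m : ℕ) :
    |closeUp x a n q (a + m) - x (a + m)| ≤
      ∑ t ∈ Finset.Ico a (a + m - n + 1), |x (t + n) - q - x t| := by
  induction m using Nat.strong_induction_on with
  | _ m ih =>
    by_cases hm : (m : ℤ) < n
    · rw [closeUp_of_mem x a n q (by omega) (by omega), sub_self, abs_zero]
      exact Finset.sum_nonneg fun _ _ => abs_nonneg _
    · obtain ⟨k, hk⟩ := Int.eq_ofNat_of_zero_le (show 0 ≤ (m : ℤ) - n by omega)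
      have h1 := ih k (by omega)
      have hc := mem_periodicSeqs_iff.1 (closeUp_mem hn x a q) (a + k)
      rw [show a + (m : ℤ) = a + k + n by omega, hc, add_sub_cancel_right]
      have h2 := sum_Ico_add_sum_Ico (fun t => |x (t + n) - q - x t|)
        (show a ≤ a + k by omega) (show a + (k : ℤ) ≤ a + k + 1 by omega)
      have h3 : ∑ t ∈ Finset.Ico (a + (k : ℤ)) (a + k + 1), |x (t + n) - q - x t|
          = |x (a + k + n) - q - x (a + k)| := by
        have : Finset.Ico (a + (k : ℤ)) (a + k + 1) = {a + (k : ℤ)} := by ext; simp; omega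
        rw [this, Finset.sum_singleton]
      have h4 : ∑ t ∈ Finset.Ico a (a + k - n + 1), |x (t + n) - q - x t|
          ≤ ∑ t ∈ Finset.Ico a (a + k), |x (t + n) - q - x t| :=
        Finset.sum_le_sum_of_subset_of_nonneg (Finset.Ico_subset_Ico le_rfl (by omega))
          fun _ _ _ => abs_nonneg _
      have h5 := abs_sub_le (closeUp x a n q (a + k)) (x (a + k)) (x (a + k + n) - q)
      rw [abs_sub_comm (x (a + k))] at h5
      have h6 : closeUp x a n q (a + k) + q - x (a + k + n)
          = closeUp x a n q (a + k) - (x (a + k + n) - q) := by ring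
      rw [h6]
      linarith

theorem abs_closeUp_sub_le {n : ℤ} (hn : 0 < n) {x : ℤ → ℝ} {a q : ℤ} {G : ℝ}
    (hG : ∑ t ∈ Finset.Ico a (a + r), |x (t + n) - q - x t| ≤ G) {j : ℤ} (h0 : a ≤ j)
    (h1 : j < a + n + r) : |closeUp x a n q j - x j| ≤ G := by
  obtain ⟨m, hm⟩ := Int.eq_ofNat_of_zero_le (show 0 ≤ j - a by omega)
  obtain rfl : j = a + m := by omega
  refine (abs_closeUp_sub_le_sum hn x a q m).trans (le_trans ?_ hG)
  exact Finset.sum_le_sum_of_subset_of_nonneg (Finset.Ico_subset_Ico le_rfl (by omega))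
    fun _ _ _ => abs_nonneg _

/-- Closing up a sequence at a site of small gap costs little action. -/
theorem periodicAction_closeUp_le (hS : IsLocalPotential S) {M E₀ K G : ℝ}
    (hK : LipschitzOnOscillation S (M + E₀) K) (hG₀ : G ≤ E₀) {x : ℤ → ℝ}
    (hx : OscillationLE r M x) {a n q : ℤ} (hn : 0 < n)
    (hG : ∑ t ∈ Finset.Ico a (a + r), |x (t + n) - q - x t| ≤ G) :
    periodicAction S n (closeUp x a n q) ≤ blockAction S a (a + n) x + r * (K * G) := by
  have hG0 : 0 ≤ G := (Finset.sum_nonneg fun _ _ => abs_nonneg _).trans hG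
  have h := abs_blockAction_sub_le hK hG0 hG₀ hx (z := closeUp x a n q) (a := a) (b := a + n)
    (fun j h0 h1 => closeUp_of_mem x a n q h0 h1)
    (fun j h0 h1 => abs_closeUp_sub_le hn hG (by omega) h1)
  rw [blockAction_eq_periodicAction hS hn.le (closeUp_mem hn x a q)] at h
  linarith [(abs_le.1 h).2]

/-! ### Subadditivity of the minimal action -/

theorem two_mul_minAction_le (hS : IsLocalPotential S) {p : ℤ} (hp : 0 < p) (q : ℤ) :
    2 * minAction S p q ≤ minAction S (2 * p) (2 * q) := by
  obtain ⟨y, hy, hym⟩ := exists_eq_minAction hS (show 0 < 2 * p by omega) (2 * q)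
  have hτ := seqTranslate_mem hy p q
  have hττ : ∀ i, seqTranslate p q y (i + p) = y i + q := fun i => by simp [seqTranslate]
  have hyτ : ∀ i, y (i + p) = seqTranslate p q y i + q := fun i => by
    have := mem_periodicSeqs_iff.1 hy (i - p)
    rw [show i - p + 2 * p = i + p by ring] at this
    simp only [seqTranslate, this]; push_cast; ring
  -- a translate of order two: the minimum and maximum of the orbit are invariant
  have hinf : y ⊓ seqTranslate p q y ∈ periodicSeqs p q := by
    rw [mem_periodicSeqs_iff]; intro i
    simp only [Pi.inf_apply]
    rw [hττ, hyτ, min_add_add_right, min_comm]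
  have hsup : y ⊔ seqTranslate p q y ∈ periodicSeqs p q := by
    rw [mem_periodicSeqs_iff]; intro i
    simp only [Pi.sup_apply]
    rw [hττ, hyτ, max_add_add_right, max_comm]
  have hsub := periodicAction_inf_add_sup_le hS (2 * p) y (seqTranslate p q y)
  rw [periodicAction_seqTranslate hS (by omega) hy] at hsub
  have e1 := periodicAction_mul hS hp.le hinf 2
  have e2 := periodicAction_mul hS hp.le hsup 2
  push_cast at e1 e2
  rw [e1, e2, hym] at hsub
  linarith [minAction_le hS hp hinf, minAction_le hS hp hsup]

theorem two_pow_mul_minAction_le (hS : IsLocalPotential S) {p : ℤ} (hp : 0 < p) (q : ℤ) (m : ℕ) :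
    2 ^ m * minAction S p q ≤ minAction S (2 ^ m * p) (2 ^ m * q) := by
  induction m with
  | zero => simp
  | succ m ih =>
    have h := two_mul_minAction_le hS (show 0 < 2 ^ m * p by positivity) (2 ^ m * q)
    rw [pow_succ', pow_succ', mul_assoc, mul_assoc, mul_assoc]
    linarith

/-- Subadditivity of the minimal action, without an error term: `2 ^ m` copies of a
`(p,q)`-minimizer followed by `2 ^ m` copies of a `(p',q')`-minimizer cost a bounded amount more
than the copies separately, and divided by `2 ^ m` this amount tends to `0`. -/
theorem minAction_add_le (hS : IsLocalPotential S) {p p' : ℤ} (hp : 0 < p) (hp' : 0 < p')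
    (q q' : ℤ) : minAction S (p + p') (q + q') ≤ minAction S p q + minAction S p' q' := by
  obtain ⟨v, hv, hvm, hvw⟩ := exists_wellOrdered_minimizer hS hp q
  obtain ⟨u, hu, hum, huw⟩ := exists_wellOrdered_minimizer hS hp' q'
  have hvo := hvw.oscillationLE le_rfl r
  have huo := huw.oscillationLE le_rfl r
  set Mv : ℝ := r * |(q : ℝ) / p| + 1 with hMv
  set Mu : ℝ := r * |(q' : ℝ) / p'| + 1 with hMu
  have hMv0 : 0 ≤ Mv := by positivity
  have hMu0 : 0 ≤ Mu := by positivity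
  set M : ℝ := Mu + |u 0 - v 0| + Mv with hM
  have hM0 : 0 ≤ M := by positivity
  have huv0 := abs_nonneg (u 0 - v 0)
  obtain ⟨K, hK⟩ := hS.exists_lipschitz (M + (r * M + M))
  have hK : LipschitzOnOscillation S (M + (r * M + M)) K := hK
  have hrM : 0 ≤ r * M := by positivity
  set ζ : ℤ → ℝ := fun j => if j < 0 then v j else u j with hζ
  have hζneg : ∀ j, j < 0 → ζ j = v j := fun j hj => if_pos hj
  have hζpos : ∀ j, 0 ≤ j → ζ j = u j := fun j hj => if_neg (not_lt.2 hj)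
  have huv : ∀ s t : ℤ, 0 ≤ s → s ≤ r → -r ≤ t → t ≤ r → |u s - v t| ≤ M := by
    intro s t hs hs' ht ht'
    have h1 := huo 0 s hs hs'
    rw [zero_add] at h1
    have h2 : |v 0 - v t| ≤ Mv := by
      rcases le_total 0 t with h | h
      · have := hvo 0 t h ht'
        rwa [zero_add, abs_sub_comm] at this
      · have := hvo t (-t) (by omega) (by omega)
        rwa [add_neg_cancel] at this
    have h3 := abs_sub_le (u s) (u 0) (v t)
    have h4 := abs_sub_le (u 0) (v 0) (v t)
    linarith
  have hζo : OscillationLE r M ζ := by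
    intro j i h0 h1
    by_cases hj : j < 0
    · rw [hζneg j hj]
      by_cases hij : j + i < 0
      · rw [hζneg _ hij]; linarith [hvo j i h0 h1]
      · rw [hζpos _ (by omega)]; exact huv _ _ (by omega) (by omega) (by omega) (by omega)
    · rw [hζpos j (by omega), hζpos _ (by omega)]; linarith [huo j i h0 h1]
  have key : ∀ m : ℕ, (r : ℝ) ≤ 2 ^ m →
      2 ^ m * (minAction S (p + p') (q + q') - (minAction S p q + minAction S p' q'))
        ≤ r * (K * (r * M)) + r * (K * M) := by
    intro m hm
    have hm' : (r : ℤ) ≤ 2 ^ m := by exact_mod_cast hm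
    have hrp : (r : ℤ) ≤ 2 ^ m * p := by nlinarith
    have hNp : 0 < (2 : ℤ) ^ m * p := by positivity
    have hNp' : 0 < (2 : ℤ) ^ m * p' := by positivity
    have hgap : ∑ t ∈ Finset.Ico (-(2 ^ m * p)) (-(2 ^ m * p) + r),
        |ζ (t + 2 ^ m * (p + p')) - ((2 ^ m * (q + q') : ℤ) : ℝ) - ζ t| ≤ r * M := by
      have hterm : ∀ t ∈ Finset.Ico (-(2 ^ m * p)) (-(2 ^ m * p) + r),
          |ζ (t + 2 ^ m * (p + p')) - ((2 ^ m * (q + q') : ℤ) : ℝ) - ζ t| ≤ M := by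
        intro t ht
        rw [Finset.mem_Ico] at ht
        have hv1 := periodicSeqs_mul hv (2 ^ m) t
        have hu1 := periodicSeqs_mul hu (2 ^ m) (t + 2 ^ m * p)
        rw [hζneg t (by omega), mul_add, ← add_assoc, hζpos _ (by omega), hu1]
        have := huv (t + 2 ^ m * p) (t + 2 ^ m * p) (by omega) (by omega) (by omega) (by omega)
        rw [hv1] at this
        push_cast at this ⊢
        convert this using 2
        ring
      refine (Finset.sum_le_card_nsmul _ _ M hterm).trans (le_of_eq ?_)
      simp
    have hclose := periodicAction_closeUp_le hS hK (by linarith) hζo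
      (show 0 < 2 ^ m * (p + p') by positivity) hgap
    have hmin := minAction_le hS (show 0 < 2 ^ m * (p + p') by positivity)
      (closeUp_mem (show 0 < 2 ^ m * (p + p') by positivity) ζ (-(2 ^ m * p)) (2 ^ m * (q + q')))
    have hpow := two_pow_mul_minAction_le hS (show 0 < p + p' by omega) (q + q') m
    rw [show -(2 ^ m * p) + 2 ^ m * (p + p') = 2 ^ m * p' by ring,
      ← blockAction_add ζ (show -(2 ^ m * p) ≤ 0 by omega) hNp'.le] at hclose
    have hleft := abs_blockAction_sub_le (S := S) (E₀ := r * M + M) hK hM0 (by linarith)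
      (hvo.mono (show Mv ≤ M by linarith)) (z := ζ) (a := -(2 ^ m * p)) (b := 0)
      (fun j _ h => hζneg j h)
      (fun j h0 h1 => by
        rw [hζpos j h0]; exact huv j j h0 (by omega) (by omega) (by omega))
    have hright : blockAction S 0 (2 ^ m * p') ζ = blockAction S 0 (2 ^ m * p') u := by
      refine Finset.sum_congr rfl fun j hj => localAction_congr fun i h1 _ => hζpos i ?_
      rw [Finset.mem_Ico] at hj; omega
    have e1 := periodicAction_mul hS hp.le hv (2 ^ m)
    have e2 := periodicAction_mul hS hp'.le hu (2 ^ m)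
    have e3 := blockAction_eq_periodicAction hS hNp.le (periodicSeqs_subset_mul p q (2 ^ m) hv)
      (-(2 ^ m * p))
    rw [neg_add_cancel] at e3
    push_cast at e1 e2
    rw [e3, e1, hvm] at hleft
    rw [hright, ← periodicAction_eq_blockAction, e2, hum] at hclose
    have := (abs_le.1 hleft).2
    linarith
  by_contra! hlt
  set D := minAction S (p + p') (q + q') - (minAction S p q + minAction S p' q') with hD
  have hD0 : 0 < D := by linarith
  obtain ⟨m, hm⟩ := pow_unbounded_of_one_lt
    (max (r : ℝ) ((r * (K * (r * M)) + r * (K * M)) / D)) (one_lt_two)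
  have h1 := key m ((le_max_left _ _).trans hm.le)
  have h2 := (le_max_right _ _).trans_lt hm
  rw [div_lt_iff₀ hD0] at h2
  linarith

/-! ### Comparison of periodic barriers -/

/-- If all windows of length `p` have total at most `A`, some block of `r` sites that starts in
`(-p, 0]` has total at most `r * A / p`. -/
theorem exists_sum_Ico_le {φ : ℤ → ℝ} {p : ℤ} (hp : 0 < p) {A : ℝ}
    (h : ∀ a, ∑ t ∈ Finset.Ico a (a + p), φ t ≤ A) (r : ℕ) :
    ∃ i : ℤ, -p < i ∧ i ≤ 0 ∧ ∑ t ∈ Finset.Ico i (i + r), φ t ≤ r * (A / p) := by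
  have hp' : (0 : ℝ) < p := by exact_mod_cast hp
  have hcard : ((p.toNat : ℕ) : ℝ) = p := by
    rw [← Int.cast_natCast, Int.toNat_of_nonneg hp.le]
  have hsum : ∑ i ∈ Finset.Ico (1 - p) (1 - p + p), ∑ t ∈ Finset.Ico i (i + r), φ t
      ≤ ∑ i ∈ Finset.Ico (1 - p) (1 - p + p), (r * (A / p) : ℝ) := by
    have e : ∀ i : ℤ, ∑ t ∈ Finset.Ico i (i + r), φ t
        = ∑ s ∈ Finset.Ico (0 : ℤ) r, φ (i + s) := fun i => by
      have := sum_Ico_comp_add φ 0 r i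
      rw [zero_add, add_comm (r : ℤ)] at this
      rw [← this]
      exact Finset.sum_congr rfl fun s _ => by rw [add_comm]
    simp_rw [e]
    rw [Finset.sum_comm]
    calc ∑ s ∈ Finset.Ico (0 : ℤ) r, ∑ i ∈ Finset.Ico (1 - p) (1 - p + p), φ (i + s)
        ≤ ∑ s ∈ Finset.Ico (0 : ℤ) r, A := Finset.sum_le_sum fun s _ => by
          rw [sum_Ico_comp_add, show 1 - p + p + s = 1 - p + s + p by ring]
          exact h _
      _ = ∑ i ∈ Finset.Ico (1 - p) (1 - p + p), (r * (A / p) : ℝ) := by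
          simp only [Finset.sum_const, Int.card_Ico, nsmul_eq_mul, add_sub_cancel_left, sub_zero,
            Int.toNat_natCast, hcard]
          field_simp
  obtain ⟨i, hi, hle⟩ := Finset.exists_le_of_sum_le ⟨1 - p, by simp [hp]⟩ hsum
  rw [Finset.mem_Ico] at hi
  exact ⟨i, by omega, by omega, hle⟩

/-- If `x` nearly returns at the site `a` after `p` steps, then closing it up there gives a
`(p,q)`-periodic sequence whose excess action is at most that of `x`, up to a small error. -/
theorem periodicAction_closeUp_sub_le (hS : IsLocalPotential S) {M E₀ K G : ℝ}
    (hK : LipschitzOnOscillation S (M + E₀) K) (hG₀ : G ≤ E₀) {p p' q q' : ℤ} (hp : 0 < p)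
    (hpp : p < p') {x : ℤ → ℝ} (hxm : x ∈ periodicSeqs p' q') (hx : OscillationLE r M x) {a : ℤ}
    (hG : ∑ t ∈ Finset.Ico a (a + r), |x (t + p) - q - x t| ≤ G) :
    periodicAction S p (closeUp x a p q) - minAction S p q
      ≤ periodicAction S p' x - minAction S p' q' + 2 * (r * (K * G)) := by
  have h1 := periodicAction_closeUp_le hS hK hG₀ hx hp hG
  -- the complementary block closes up at the same cost
  have hG' : ∑ t ∈ Finset.Ico (a + p) (a + p + r),
      |x (t + (p' - p)) - ((q' - q : ℤ) : ℝ) - x t| ≤ G := by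
    have e := sum_Ico_comp_add (fun t => |x (t + (p' - p)) - ((q' - q : ℤ) : ℝ) - x t|) a (a + r) p
    rw [show a + p + r = a + r + p by ring, ← e]
    refine le_trans (le_of_eq ?_) hG
    refine Finset.sum_congr rfl fun t _ => ?_
    have := mem_periodicSeqs_iff.1 hxm t
    rw [show t + p + (p' - p) = t + p' by ring, this, ← abs_neg]
    congr 1
    push_cast; ring
  have h2 := periodicAction_closeUp_le hS hK hG₀ hx (show 0 < p' - p by omega) hG'
  have h3 := minAction_le hS (show 0 < p' - p by omega)
    (closeUp_mem (show 0 < p' - p by omega) x (a + p) (q' - q))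
  have h4 := minAction_add_le hS hp (show 0 < p' - p by omega) q (q' - q)
  rw [add_sub_cancel, add_sub_cancel] at h4
  have h5 := blockAction_add (S := S) x (show a ≤ a + p by omega)
    (show a + p ≤ a + p + (p' - p) by omega)
  rw [show a + p + (p' - p) = a + p' by ring, blockAction_eq_periodicAction hS (by omega) hxm] at h5
  rw [show a + p + (p' - p) = a + p' by ring] at h2
  linarith

/-- A pinned sequence can be moved between two near-minimizers that enclose it at the site `0`. -/
theorem exists_pinned_mem_Icc (hS : IsLocalPotential S) {p q : ℤ} (hp : 0 < p) {w₁ w₂ : ℤ → ℝ}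
    (hw₁ : w₁ ∈ periodicSeqs p q) (hw₂ : w₂ ∈ periodicSeqs p q) (hw : w₁ ≤ w₂) {ξ e : ℝ}
    (h₁ : periodicAction S p w₁ ≤ minAction S p q + e)
    (h₂ : periodicAction S p w₂ ≤ minAction S p q + e) (hξ₁ : w₁ 0 ≤ ξ) (hξ₂ : ξ ≤ w₂ 0) :
    ∃ x ∈ periodicSeqs p q, x 0 = ξ ∧ w₁ ≤ x ∧ x ≤ w₂ ∧
      periodicAction S p x ≤ pinnedMinAction S p q ξ + 2 * e := by
  obtain ⟨v, hv, hv0, hvm⟩ := exists_eq_pinnedMinAction hS hp q ξ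
  have hs := sup_mem_periodicSeqs hv hw₁
  refine ⟨(v ⊔ w₁) ⊓ w₂, inf_mem_periodicSeqs hs hw₂, ?_, le_inf le_sup_right hw, inf_le_right, ?_⟩
  · simp [hv0, hξ₁, hξ₂]
  · have h3 := periodicAction_inf_add_sup_le hS p v w₁
    have h4 := periodicAction_inf_add_sup_le hS p (v ⊔ w₁) w₂
    have h5 := minAction_le hS hp (inf_mem_periodicSeqs hv hw₁)
    have h6 := minAction_le hS hp (sup_mem_periodicSeqs hs hw₂)
    linarith

/-- The Peierls barrier of a rational `q / p` in lowest terms, in terms of `p` and `q`. -/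
def barrier (S : (Fin (r + 1) → ℝ) → ℝ) (p q : ℤ) (ξ : ℝ) : ℝ :=
  pinnedMinAction S p q ξ - minAction S p q

/-- The comparison of the barriers of two rationals: a sequence of the larger period `p'` is cut
at a site where both it and its next translate nearly return after `p` steps. -/
theorem exists_barrier_estimate_of_lt (hS : IsLocalPotential S) (L : ℝ) :
    ∃ C : ℝ, 0 < C ∧ ∀ p q p' q' : ℤ, 0 < p → p < p' → IsCoprime p q → IsCoprime p' q' →
      |(q' : ℝ) / p'| ≤ L → |(p : ℝ) * (q' / p') - q| ≤ 1 → ∀ ξ : ℝ,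
        |barrier S p' q' ξ - barrier S p q ξ|
          ≤ C * (1 / p + |(p : ℝ) * (q' / p') - q|) := by
  set M : ℝ := r * L + 1 + 1 with hM
  set E₀ : ℝ := 16 * r with hE₀
  obtain ⟨K, hK⟩ := hS.exists_lipschitz (M + E₀)
  have hK : LipschitzOnOscillation S (M + E₀) K := hK
  have hK0 := hK.1
  refine ⟨8 * (r * (K * (4 * r))) + 1, by positivity, fun p q p' q' hp hpp hpq hpq' hΩ hd ξ => ?_⟩
  have hp' : 0 < p' := by omega
  have hpR : (1 : ℝ) ≤ p := by exact_mod_cast hp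
  have hpR0 : (0 : ℝ) < p := by linarith
  set d := |(p : ℝ) * (q' / p') - q| with hdef
  have hd0 : 0 ≤ d := abs_nonneg _
  obtain ⟨y, hy, z, hz, hym, hzm, hyw, hzw, hyz, hyξ, hξz, hδ⟩ := exists_bracket hS hp' hpq' ξ
  have hδ' : ∀ a, ∑ t ∈ Finset.Ico a (a + p), (z t - y t) ≤ 1 := fun a =>
    (Finset.sum_le_sum_of_subset_of_nonneg (Finset.Ico_subset_Ico le_rfl (by omega))
      fun t _ _ => sub_nonneg.2 (hyz t)).trans (hδ a)
  have hz1 : ∀ t, z t ≤ y t + 1 := fun t => by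
    have h := Finset.single_le_sum (f := fun t => z t - y t) (s := Finset.Ico t (t + p))
      (fun t _ => sub_nonneg.2 (hyz t)) (Finset.mem_Ico.2 ⟨le_rfl, by omega⟩)
    linarith [hδ' t]
  -- the quantities that have to be small where the sequences are cut
  set φ : ℤ → ℝ := fun t => |y (t + p) - q - y t| + |z (t + p) - q - z t|
    + ((z t - y t) + (z (t + p) - y (t + p))) with hφ
  have hφsum : ∀ a, ∑ t ∈ Finset.Ico a (a + p), φ t ≤ 4 * p * d + 4 := by
    intro a
    simp only [hφ, Finset.sum_add_distrib]
    have h1 := hyw.sum_gap_le hp hpq a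
    have h2 := hzw.sum_gap_le hp hpq a
    have h3 := hδ' a
    have h4 := hδ' (a + p)
    rw [← sum_Ico_comp_add (fun t => z t - y t) a (a + p) p] at h4
    linarith
  obtain ⟨i, hi, hi0, hiφ⟩ := exists_sum_Ico_le hp hφsum r
  set G : ℝ := 4 * r * (1 / p + d) with hG
  have hiφ : ∑ t ∈ Finset.Ico i (i + r), φ t ≤ G := by
    refine hiφ.trans (le_of_eq ?_)
    rw [hG]; field_simp; ring
  have hG0 : 0 ≤ G := by positivity
  have hGE : 2 * G ≤ E₀ := by
    have h1 : 1 / (p : ℝ) ≤ 1 := by rw [div_le_one hpR0]; exact hpR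
    have h2 : (r : ℝ) * (1 / p + d) ≤ r * 2 := by gcongr; linarith
    rw [hG, hE₀]; linarith
  have hφ_gap : ∀ {x : ℤ → ℝ}, y ≤ x → x ≤ z → ∀ t, |x (t + p) - q - x t| ≤ φ t := by
    intro x hyx hxz t
    have h1 := abs_le.1 (le_refl |y (t + p) - q - y t|)
    have a0 := abs_nonneg (z (t + p) - q - z t)
    have a1 := hyx t
    have a2 := hyx (t + p)
    have a3 := hxz t
    have a4 := hxz (t + p)
    rw [abs_le]
    constructor <;> linarith [h1.1, h1.2]
  have hφ_dist : ∀ t, z t - y t ≤ φ t ∧ z (t + p) - y (t + p) ≤ φ t := fun t => by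
    have a0 := abs_nonneg (z (t + p) - q - z t)
    have a1 := abs_nonneg (y (t + p) - q - y t)
    have a2 := hyz t
    have a3 := hyz (t + p)
    constructor <;> linarith
  have hφ_nonneg : ∀ t, 0 ≤ φ t := fun t => (sub_nonneg.2 (hyz t)).trans (hφ_dist t).1
  have hφ_single : ∀ t, i ≤ t → t < i + r → φ t ≤ G := fun t h0 h1 =>
    (Finset.single_le_sum (fun t _ => hφ_nonneg t) (Finset.mem_Ico.2 ⟨h0, h1⟩)).trans hiφ
  have hgap : ∀ {x : ℤ → ℝ}, y ≤ x → x ≤ z →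
      ∑ t ∈ Finset.Ico i (i + r), |x (t + p) - q - x t| ≤ G := fun hyx hxz =>
    (Finset.sum_le_sum fun t _ => hφ_gap hyx hxz t).trans hiφ
  have hyo : OscillationLE r (r * L + 1) y := hyw.oscillationLE hΩ r
  have hosc : ∀ {x : ℤ → ℝ}, y ≤ x → x ≤ z → OscillationLE r M x := fun hyx hxz =>
    hyo.of_mem_Icc hyx hxz hz1
  have hcut : ∀ {x : ℤ → ℝ}, x ∈ periodicSeqs p' q' → y ≤ x → x ≤ z →
      periodicAction S p (closeUp x i p q) - minAction S p q
        ≤ periodicAction S p' x - minAction S p' q' + 2 * (r * (K * G)) := fun hx hyx hxz =>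
    periodicAction_closeUp_sub_le hS hK (by linarith) hp hpp hx (hosc hyx hxz) (hgap hyx hxz)
  have hfin : 8 * (r * (K * G)) ≤ (8 * (r * (K * (4 * r))) + 1) * (1 / p + d) := by
    have : 0 ≤ 1 / (p : ℝ) + d := by positivity
    rw [hG]; nlinarith
  have hKG : 0 ≤ r * (K * G) := by positivity
  have hyC := hcut hy le_rfl hyz
  have hzC := hcut hz hyz le_rfl
  unfold barrier
  rw [abs_le]
  constructor
  · -- close up a pinned minimizer of period `p'`
    obtain ⟨x, hx, hx0, hyx, hxz, hxm⟩ := exists_pinned_mem_Icc hS hp' hy hz hyz (ξ := ξ) (e := 0)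
      (by linarith) (by linarith) hyξ hξz
    have h1 := hcut hx hyx hxz
    have h2 := pinnedMinAction_le hS hp (closeUp_mem hp x i q)
    rw [closeUp_of_mem x i p q hi0 (by omega), hx0] at h2
    linarith
  · -- glue a pinned minimizer of period `p` into `y`, having moved it close to `y`
    have hw0 : ∀ x : ℤ → ℝ, closeUp x i p q 0 = x 0 := fun x =>
      closeUp_of_mem x i p q hi0 (by omega)
    obtain ⟨v, hv, hv0, hyv, hvz, hvm⟩ := exists_pinned_mem_Icc hS hp (closeUp_mem hp y i q)
      (closeUp_mem hp z i q) (closeUp_mono hyz i p q) (ξ := ξ) (e := 2 * (r * (K * G)))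
      (by linarith) (by linarith) (by rwa [hw0]) (by rwa [hw0])
    set x : ℤ → ℝ := closeUp (fun j => if j < i + p then v j else y j) i p' q' with hx
    have hxm : x ∈ periodicSeqs p' q' := closeUp_mem hp' _ _ _
    have hxv : ∀ j, i ≤ j → j < i + p → x j = v j := fun j h0 h1 => by
      rw [hx, closeUp_of_mem _ _ _ _ h0 (by omega), if_pos h1]
    have hxy : ∀ j, i + p ≤ j → j < i + p' → x j = y j := fun j h0 h1 => by
      rw [hx, closeUp_of_mem _ _ _ _ (by omega) h1, if_neg (by omega)]
    have hmem : ∀ j, y j ≤ x j ∧ x j ≤ z j := by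
      intro j
      obtain ⟨n, hn⟩ := exists_mem_Ico_add_mul hp' i j
      rw [Finset.mem_Ico] at hn
      have e1 := periodicSeqs_mul hy n j
      have e2 := periodicSeqs_mul hz n j
      have e3 := periodicSeqs_mul hxm n j
      by_cases h : j + n * p' < i + p
      · have h1 := hyv (j + n * p')
        have h2 := hvz (j + n * p')
        rw [closeUp_of_mem _ _ _ _ hn.1 h] at h1 h2
        rw [hxv _ hn.1 h] at e3
        constructor <;> linarith
      · have h1 := hxy _ (not_lt.1 h) hn.2
        have h2 := hyz (j + n * p')
        constructor <;> linarith
    have hyx : y ≤ x := fun j => (hmem j).1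
    have hxz : x ≤ z := fun j => (hmem j).2
    have hx0 : x 0 = ξ := by rw [hxv 0 hi0 (by omega), hv0]
    have hleft := abs_blockAction_sub_le hK (E := 2 * G) (by linarith) hGE (hosc hyx hxz) (z := v)
      (a := i) (b := i + p) (fun j h0 h1 => (hxv j h0 h1).symm) (fun j h0 h1 => by
        have a1 := abs_le.1 (abs_closeUp_sub_le hp (hgap le_rfl hyz) (show i ≤ j by omega) h1)
        have a2 := abs_le.1 (abs_closeUp_sub_le hp (hgap hyz le_rfl) (show i ≤ j by omega) h1)
        have a3 := (hφ_dist (j - p)).2.trans (hφ_single (j - p) (by omega) (by omega))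
        rw [sub_add_cancel] at a3
        have a4 := hyv j
        have a5 := hvz j
        have a6 := hmem j
        rw [abs_le]
        constructor <;> linarith [a1.1, a2.2, a6.1, a6.2])
    have hright := abs_blockAction_sub_le hK (E := G) hG0 (by linarith) (hosc le_rfl hyz) (z := x)
      (a := i + p) (b := i + p') hxy (fun j h0 h1 => by
        have a1 := mem_periodicSeqs_iff.1 hy (j - p')
        have a2 := mem_periodicSeqs_iff.1 hz (j - p')
        rw [sub_add_cancel] at a1 a2
        have a3 := (hφ_dist (j - p')).1.trans (hφ_single (j - p') (by omega) (by omega))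
        have a6 := hmem j
        rw [abs_le]
        constructor <;> linarith [a6.1, a6.2])
    rw [blockAction_eq_periodicAction hS hp.le hv] at hleft
    have hsumx := blockAction_add (S := S) x (show i ≤ i + p by omega)
      (show i + p ≤ i + p' by omega)
    have hsumy := blockAction_add (S := S) y (show i ≤ i + p by omega)
      (show i + p ≤ i + p' by omega)
    rw [blockAction_eq_periodicAction hS hp'.le hxm] at hsumx
    rw [blockAction_eq_periodicAction hS hp'.le hy] at hsumy
    have hwin := periodicAction_closeUp_le hS hK (by linarith) (hosc le_rfl hyz) hp
      (hgap le_rfl hyz)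
    have hmin := minAction_le hS hp (closeUp_mem hp y i q)
    have hpin := pinnedMinAction_le hS hp' hxm
    rw [hx0] at hpin
    have h1 := (abs_le.1 hleft).1
    have h2 := (abs_le.1 hright).2
    linarith

theorem barrier_nonneg (hS : IsLocalPotential S) {p : ℤ} (hp : 0 < p) (q : ℤ) (ξ : ℝ) :
    0 ≤ barrier S p q ξ :=
  sub_nonneg.2 (minAction_le_pinnedMinAction hS hp q ξ)

theorem exists_barrier_le_of_period_one (hS : IsLocalPotential S) (L : ℝ) :
    ∃ B : ℝ, 0 < B ∧ ∀ n : ℤ, |(n : ℝ)| ≤ L → ∀ ξ : ℝ, barrier S 1 n ξ ≤ B := by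
  obtain ⟨K, hK0, hK⟩ := hS.exists_lipschitz (r * L)
  refine ⟨K, hK0, fun n hn ξ => ?_⟩
  obtain ⟨u, hu, hum⟩ := exists_eq_minAction hS one_pos n
  have hx : (fun i : ℤ => ξ + i * ((n : ℝ) / (1 : ℤ))) ∈ periodicSeqs 1 n :=
    linear_mem_periodicSeqs one_pos ξ
  have hv := seqTranslate_mem hu 0 ⌊ξ - u 0⌋
  have hva := periodicAction_seqTranslate hS zero_le_one hu 0 ⌊ξ - u 0⌋
  set v := seqTranslate 0 ⌊ξ - u 0⌋ u with hvdef
  have hv0 : |ξ - v 0| ≤ 1 := by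
    have h1 := Int.floor_le (ξ - u 0)
    have h2 := Int.lt_floor_add_one (ξ - u 0)
    simp only [hvdef, seqTranslate, sub_self]
    rw [abs_le]; constructor <;> linarith
  have hvi : ∀ i : ℤ, v i = v 0 + i * n := fun i => by
    have := periodicSeqs_mul hv i 0
    simpa using this
  have hpin := pinnedMinAction_le hS one_pos hx
  have e : ∀ w : ℤ → ℝ, periodicAction S 1 w = localAction S w 0 := fun w => by
    have : Finset.Ico (0 : ℤ) 1 = {0} := by ext; simp; omega
    simp [periodicAction_eq_blockAction, blockAction, this]
  have hosc : ∀ i : Fin (r + 1), |((i : ℕ) : ℝ) * n| ≤ r * L := fun i => by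
    have : ((i : ℕ) : ℝ) ≤ r := by exact_mod_cast (show (i : ℕ) ≤ r by omega)
    rw [abs_mul, Nat.abs_cast]
    gcongr
  have hle := hK
    (fun i : Fin (r + 1) => ξ + (((0 : ℤ) + ((i : ℕ) : ℤ) : ℤ) : ℝ) * ((n : ℝ) / (1 : ℤ)))
    (fun i : Fin (r + 1) => v (0 + ((i : ℕ) : ℤ)))
    (fun i => by simpa using hosc i)
    (fun i => by rw [hvi, hvi (0 + _)]; simpa using hosc i)
    1 (fun i => by rw [hvi]; simpa using hv0)
  have hle' : |periodicAction S 1 (fun i : ℤ => ξ + i * ((n : ℝ) / (1 : ℤ))) -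
      periodicAction S 1 v| ≤ K * 1 := by
    rw [e, e]; exact hle
  rw [hva, hum] at hle'
  simp only [Int.cast_zero, zero_mul, add_zero] at hpin
  unfold barrier
  linarith [(abs_le.1 hle').2]

theorem exists_barrier_le (hS : IsLocalPotential S) (L : ℝ) :
    ∃ B : ℝ, 0 < B ∧ ∀ p q : ℤ, 0 < p → IsCoprime p q → |(q : ℝ) / p| ≤ L → ∀ ξ : ℝ,
      barrier S p q ξ ≤ B := by
  obtain ⟨B, hB0, hB⟩ := exists_barrier_le_of_period_one hS (L + 1)
  obtain ⟨C, hC0, hC⟩ := exists_barrier_estimate_of_lt hS L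
  refine ⟨B + 2 * C, by positivity, fun p q hp hpq hΩ ξ => ?_⟩
  rcases (show 1 ≤ p by omega).eq_or_lt with rfl | h1
  · have := hB q (by simp at hΩ; linarith) ξ
    linarith
  · have hr := abs_sub_round ((q : ℝ) / p)
    set n := round ((q : ℝ) / p) with hn
    have hnL : |(n : ℝ)| ≤ L + 1 := by
      have := abs_sub_abs_le_abs_sub (n : ℝ) ((q : ℝ) / p)
      rw [abs_sub_comm] at this
      linarith
    have h2 := hC 1 n p q one_pos h1 isCoprime_one_left hpq hΩ
      (by push_cast; rw [one_mul]; linarith) ξ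
    have h3 := hB n hnL ξ
    push_cast at h2
    rw [one_mul, div_one] at h2
    have h4 : C * (1 + |(q : ℝ) / p - n|) ≤ C * 2 := by gcongr; linarith
    linarith [(abs_le.1 h2).2]

/-- The estimate without restriction on the periods. If the second period is the smaller one, the
roles can be exchanged, since then `1 / p' ≤ |p q' / p' - q|`. -/
theorem exists_barrier_estimate (hS : IsLocalPotential S) (L : ℝ) :
    ∃ C : ℝ, 0 < C ∧ ∀ p q p' q' : ℤ, 0 < p → 0 < p' → IsCoprime p q → IsCoprime p' q' →
      |(q : ℝ) / p| ≤ L → |(q' : ℝ) / p'| ≤ L → ∀ ξ : ℝ,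
        |barrier S p' q' ξ - barrier S p q ξ|
          ≤ C * (1 / p + |(p : ℝ) * (q' / p') - q|) := by
  obtain ⟨B, hB0, hB⟩ := exists_barrier_le hS L
  obtain ⟨C, hC0, hC⟩ := exists_barrier_estimate_of_lt hS L
  refine ⟨2 * C + B, by positivity, fun p q p' q' hp hp' hpq hpq' hΩ hΩ' ξ => ?_⟩
  have hpR : (0 : ℝ) < p := by exact_mod_cast hp
  have hpR' : (0 : ℝ) < p' := by exact_mod_cast hp'
  set d := |(p : ℝ) * (q' / p') - q| with hd
  have hd0 : 0 ≤ d := abs_nonneg _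
  have hip : 0 ≤ 1 / (p : ℝ) := by positivity
  have hdk : d * p' = |((p * q' - q * p' : ℤ) : ℝ)| := by
    rw [hd, ← abs_of_pos hpR', ← abs_mul, abs_of_pos hpR']
    congr 1
    push_cast
    field_simp
  rcases le_or_gt 1 d with h1 | h1
  · have b1 := hB p q hp hpq hΩ ξ
    have b2 := hB p' q' hp' hpq' hΩ' ξ
    have b3 := barrier_nonneg hS hp q ξ
    have b4 := barrier_nonneg hS hp' q' ξ
    have : |barrier S p' q' ξ - barrier S p q ξ| ≤ B := by
      rw [abs_le]; constructor <;> linarith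
    nlinarith
  rcases lt_trichotomy p p' with h | h | h
  · have := hC p q p' q' hp h hpq hpq' hΩ' h1.le ξ
    nlinarith
  · subst h
    have hk : |((p * q' - q * p : ℤ) : ℝ)| < p := by rw [← hdk]; nlinarith
    have hk' : |(p * (q' - q) : ℤ)| < p := by
      rw [show p * (q' - q) = p * q' - q * p by ring]; exact_mod_cast hk
    have : q' - q = 0 := by
      by_contra hne
      have := Int.one_le_abs hne
      rw [abs_mul, abs_of_pos hp] at hk'
      nlinarith
    obtain rfl : q' = q := by omega
    rw [sub_self, abs_zero]
    positivity
  · have hk1 : 1 ≤ |(p * q' - q * p' : ℤ)| := by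
      refine Int.one_le_abs fun h0 => ?_
      have : p ∣ p' := hpq.dvd_of_dvd_mul_left ⟨q', by linarith⟩
      exact absurd (Int.le_of_dvd hp' this) (by omega)
    have hk1' : (1 : ℝ) ≤ d * p' := by rw [hdk]; exact_mod_cast hk1
    have hd1 : 1 / (p' : ℝ) ≤ d := by rw [div_le_iff₀ hpR']; exact hk1'
    have hdd : |(p' : ℝ) * (q / p) - q'| ≤ d := by
      have e : |(p' : ℝ) * (q / p) - q'| * p = d * p' := by
        rw [hdk, ← abs_of_pos hpR, ← abs_mul, abs_of_pos hpR, ← abs_neg]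
        congr 1
        push_cast
        field_simp
        ring
      have h2 : (p' : ℝ) ≤ p := by exact_mod_cast h.le
      refine le_of_mul_le_mul_right ?_ hpR
      rw [e]
      gcongr
    have := hC p' q' p q hp' h hpq' hpq hΩ (by linarith) ξ
    rw [abs_sub_comm] at this
    have h3 : C * (1 / p' + |(p' : ℝ) * (q / p) - q'|) ≤ C * (d + d) := by gcongr
    nlinarith

/-! ### Irrational rotation numbers -/

theorem isCoprime_den_num (s : ℚ) : IsCoprime (s.den : ℤ) s.num := by
  rw [Int.isCoprime_iff_gcd_eq_one, Int.gcd_comm]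
  exact s.reduced

/-- The bound `1 / |p| + |p * ω - q|` of the comparison estimate, for `s = q / p`. -/
def approxError (s : ℚ) (ω : ℝ) : ℝ := 1 / (s.den : ℝ) + |(s.den : ℝ) * ω - s.num|

theorem exists_periodicPeierlsBarrier_estimate (hS : IsLocalPotential S) (L : ℝ) :
    ∃ C : ℝ, 0 < C ∧ ∀ s t : ℚ, |(s : ℝ)| ≤ L → |(t : ℝ)| ≤ L → ∀ ξ : ℝ,
      |periodicPeierlsBarrier S t ξ - periodicPeierlsBarrier S s ξ| ≤ C * approxError s t := by
  obtain ⟨C, hC0, hC⟩ := exists_barrier_estimate hS L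
  refine ⟨C, hC0, fun s t hs ht ξ => ?_⟩
  rw [Rat.cast_def] at hs ht
  have h := hC s.den s.num t.den t.num (by exact_mod_cast s.pos) (by exact_mod_cast t.pos)
    (isCoprime_den_num s) (isCoprime_den_num t) (by exact_mod_cast hs) (by exact_mod_cast ht) ξ
  simp only [Int.cast_natCast] at h
  rw [approxError, Rat.cast_def t]
  exact h

theorem continuous_approxError (s : ℚ) : Continuous (approxError s) := by
  unfold approxError; fun_prop

theorem exists_rat_approxError_lt {ω : ℝ} (hω : Irrational ω) {ε : ℝ} (hε : 0 < ε) :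
    ∃ s : ℚ, |(s : ℝ)| ≤ |ω| + 1 ∧ approxError s ω < ε := by
  obtain ⟨N, hN⟩ := exists_nat_one_div_lt (half_pos hε)
  have hev := hω.eventually_forall_le_dist_cast_rat_of_den_le N
  obtain ⟨δ, hδ, hδ0⟩ := ((hev.filter_mono nhdsWithin_le_nhds).and
    (self_mem_nhdsWithin : Set.Ioi (0 : ℝ) ∈ 𝓝[>] 0)).exists
  obtain ⟨n, hn⟩ := exists_nat_one_div_lt (lt_min hδ0 (half_pos hε))
  obtain ⟨s, hs, -⟩ := Real.exists_rat_abs_sub_le_and_den_le ω (Nat.succ_pos n)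
  have hd : (1 : ℝ) ≤ s.den := by exact_mod_cast s.pos
  have hn0 : (0 : ℝ) ≤ n := Nat.cast_nonneg n
  have hle : 1 / ((((n + 1 : ℕ) : ℝ) + 1) * s.den) ≤ 1 / ((n : ℝ) + 1) := by
    apply one_div_le_one_div_of_le (by positivity)
    push_cast; nlinarith
  refine ⟨s, ?_, ?_⟩
  · have h1 : 1 / ((n : ℝ) + 1) ≤ 1 := by rw [div_le_one (by positivity)]; linarith
    have := abs_sub_abs_le_abs_sub (s : ℝ) ω
    rw [abs_sub_comm] at this
    linarith
  · have hden : N < s.den := by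
      by_contra! hle'
      have h1 := hδ s hle'
      rw [Real.dist_eq] at h1
      linarith [hn.trans_le (min_le_left _ _)]
    have h1 : 1 / (s.den : ℝ) < ε / 2 := by
      refine lt_of_le_of_lt (one_div_le_one_div_of_le (by positivity) ?_) hN
      exact_mod_cast hden
    have h2 : |(s.den : ℝ) * ω - s.num| < ε / 2 := by
      have e : (s.den : ℝ) * ω - s.num = s.den * (ω - s) := by
        rw [Rat.cast_def]; field_simp
      rw [e, abs_mul, Nat.abs_cast]
      calc (s.den : ℝ) * |ω - s| ≤ s.den * (1 / ((((n + 1 : ℕ) : ℝ) + 1) * s.den)) := by gcongr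
        _ = 1 / (((n + 1 : ℕ) : ℝ) + 1) := by field_simp
        _ ≤ 1 / ((n : ℝ) + 1) := one_div_le_one_div_of_le (by positivity) (by push_cast; linarith)
        _ < ε / 2 := hn.trans_le (min_le_right _ _)
    unfold approxError; linarith

theorem neBot_comap_ratCast (ω : ℝ) : (comap (fun s : ℚ => (s : ℝ)) (𝓝 ω)).NeBot :=
  Rat.isDenseEmbedding_coe_real.isDenseInducing.comap_nhds_neBot ω

theorem eventually_abs_le_add_one (ω : ℝ) : ∀ᶠ Ω in 𝓝 ω, |Ω| ≤ |ω| + 1 :=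
  (continuous_abs.tendsto ω).eventually_le_const (by linarith)

theorem tendsto_periodicPeierlsBarrier (hS : IsLocalPotential S) {ω : ℝ} (hω : Irrational ω)
    (ξ : ℝ) : Tendsto (fun s : ℚ => periodicPeierlsBarrier S s ξ)
      (comap (fun s : ℚ => (s : ℝ)) (𝓝 ω)) (𝓝 (peierlsBarrier S ω ξ)) := by
  have hnot : ¬ ∃ s : ℚ, (s : ℝ) = ω := hω
  have : (comap (fun s : ℚ => (s : ℝ)) (𝓝 ω)).NeBot := neBot_comap_ratCast ω
  obtain ⟨C, hC0, hC⟩ := exists_periodicPeierlsBarrier_estimate hS (|ω| + 1)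
  unfold peierlsBarrier
  rw [dif_neg hnot]
  apply tendsto_nhds_limUnder
  rw [← cauchy_map_iff_exists_tendsto, Metric.cauchy_iff]
  refine ⟨inferInstance, fun ε hε => ?_⟩
  obtain ⟨s, hs, hsε⟩ := exists_rat_approxError_lt hω (show 0 < ε / (2 * C) by positivity)
  have hev : ∀ᶠ Ω in 𝓝 ω, |Ω| ≤ |ω| + 1 ∧ approxError s Ω < ε / (2 * C) :=
    (eventually_abs_le_add_one ω).and
      (((continuous_approxError s).tendsto ω).eventually_lt_const hsε)
  refine ⟨_, image_mem_map (preimage_mem_comap hev), ?_⟩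
  rintro _ ⟨t, ht, rfl⟩ _ ⟨t', ht', rfl⟩
  have h1 := hC s t hs ht.1 ξ
  have h2 := hC s t' hs ht'.1 ξ
  have a1 : C * approxError s t < ε / 2 := by
    have := mul_lt_mul_of_pos_left ht.2 hC0
    rwa [show C * (ε / (2 * C)) = ε / 2 by field_simp] at this
  have a2 : C * approxError s t' < ε / 2 := by
    have := mul_lt_mul_of_pos_left ht'.2 hC0
    rwa [show C * (ε / (2 * C)) = ε / 2 by field_simp] at this
  have h3 := abs_sub_le (periodicPeierlsBarrier S t ξ) (periodicPeierlsBarrier S s ξ)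
    (periodicPeierlsBarrier S t' ξ)
  rw [abs_sub_comm (periodicPeierlsBarrier S s ξ)] at h3
  rw [Real.dist_eq]
  linarith

theorem exists_peierlsBarrier_estimate (hS : IsLocalPotential S) (L : ℝ) :
    ∃ C : ℝ, 0 < C ∧ ∀ ω : ℝ, |ω| ≤ L → ∀ s : ℚ, |(s : ℝ)| ≤ L → ∀ ξ : ℝ,
      |peierlsBarrier S ω ξ - periodicPeierlsBarrier S s ξ| ≤ C * approxError s ω := by
  obtain ⟨C, hC0, hC⟩ := exists_periodicPeierlsBarrier_estimate hS (L + 1)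
  refine ⟨C, hC0, fun ω hω s hs ξ => ?_⟩
  by_cases hirr : Irrational ω
  · have := neBot_comap_ratCast ω
    have h1 := ((tendsto_periodicPeierlsBarrier hS hirr ξ).sub_const
      (periodicPeierlsBarrier S s ξ)).abs
    have h2 : Tendsto (fun t : ℚ => C * approxError s t) (comap (fun s : ℚ => (s : ℝ)) (𝓝 ω))
        (𝓝 (C * approxError s ω)) :=
      (((continuous_approxError s).tendsto ω).comp tendsto_comap).const_mul C
    refine le_of_tendsto_of_tendsto h1 h2 ?_
    filter_upwards [preimage_mem_comap (eventually_abs_le_add_one ω)] with t ht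
    exact hC s t (by linarith) (by have : |(t : ℝ)| ≤ |ω| + 1 := ht; linarith) ξ
  · obtain ⟨t, rfl⟩ : ∃ t : ℚ, (t : ℝ) = ω := by
      simpa [Irrational] using hirr
    rw [peierlsBarrier_ratCast]
    exact hC s t (by linarith) (by linarith) ξ

theorem approxError_div {p q : ℤ} (hp : p ≠ 0) (hpq : IsCoprime p q) (ω : ℝ) :
    approxError ((q : ℚ) / p) ω = 1 / |(p : ℝ)| + |(p : ℝ) * ω - q| := by
  have key : ∀ {p q : ℤ}, 0 < p → IsCoprime p q →
      approxError ((q : ℚ) / p) ω = 1 / |(p : ℝ)| + |(p : ℝ) * ω - q| := by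
    intro p q hp hpq
    have hc : Nat.Coprime q.natAbs p.natAbs := by
      have := Int.isCoprime_iff_gcd_eq_one.1 hpq.symm
      exact this
    have h1 := Rat.num_div_eq_of_coprime hp hc
    have h2 := Rat.den_div_eq_of_coprime hp hc
    have hpR : (0 : ℝ) < p := by exact_mod_cast hp
    unfold approxError
    rw [h1, ← Int.cast_natCast, h2, abs_of_pos hpR]
  rcases hp.lt_or_gt with h | h
  · have := key (show 0 < -p by omega) hpq.neg_neg
    push_cast at this
    rw [neg_div_neg_eq] at this
    rw [this, abs_neg, ← abs_neg (-(p : ℝ) * ω - _)]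
    congr 2
    ring
  · exact key h hpq

theorem tendstoUniformly_peierlsBarrier (hS : IsLocalPotential S) {ω : ℝ} (hω : Irrational ω) :
    TendstoUniformly (fun Ω ξ : ℝ => peierlsBarrier S Ω ξ) (peierlsBarrier S ω) (𝓝 ω) := by
  obtain ⟨C, hC0, hC⟩ := exists_peierlsBarrier_estimate hS (|ω| + 1)
  rw [Metric.tendstoUniformly_iff]
  intro ε hε
  obtain ⟨s, hs, hsε⟩ := exists_rat_approxError_lt hω (show 0 < ε / (2 * C) by positivity)
  have e : C * (ε / (2 * C)) = ε / 2 := by field_simp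
  filter_upwards [eventually_abs_le_add_one ω,
    ((continuous_approxError s).tendsto ω).eventually_lt_const hsε] with Ω h1 h2 ξ
  have a1 := hC ω (by linarith) s hs ξ
  have a2 := hC Ω h1 s hs ξ
  have b1 := mul_lt_mul_of_pos_left hsε hC0
  have b2 := mul_lt_mul_of_pos_left h2 hC0
  have a3 := abs_sub_le (peierlsBarrier S ω ξ) (periodicPeierlsBarrier S s ξ)
    (peierlsBarrier S Ω ξ)
  rw [abs_sub_comm (periodicPeierlsBarrier S s ξ)] at a3
  rw [Real.dist_eq]
  linarith

/-! ### Diophantine rotation numbers -/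

theorem IsDiophantine.gamma_le_one {γ τ ω : ℝ} (h : IsDiophantine γ τ ω) : γ ≤ 1 := by
  have h1 := h.2.2 1 (round ω) one_ne_zero
  simp only [Int.cast_one, abs_one, Real.one_rpow, div_one, one_mul] at h1
  linarith [abs_sub_round ω]

/-- A rational with denominator at most `N` and `|p * ω - q| ≤ 1 / (N + 1)` has, at a Diophantine
`ω`, a denominator of at least `(γ * (N + 1)) ^ (1 / τ)`; the choice `N = ⌊ε ^ (-1/2)⌋`
balances the three quantities. -/
theorem IsDiophantine.exists_rat {γ τ ω ε : ℝ} (h : IsDiophantine γ τ ω) (hε : 0 < ε)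
    (hε1 : ε ≤ 1) :
    ∃ s : ℚ, |(s : ℝ)| ≤ |ω| + 1 ∧ 1 / (s.den : ℝ) ≤ ε ^ (1 / (2 * τ)) / γ ^ (1 / τ) ∧
      |(s.den : ℝ) * ω - s.num| ≤ ε ^ (1 / (2 * τ)) / γ ^ (1 / τ) ∧
      s.den * ε ≤ ε ^ (1 / (2 * τ)) / γ ^ (1 / τ) := by
  obtain ⟨hγ, hτ, hdio⟩ := id h
  have hτ0 : 0 < τ := by linarith
  set a : ℝ := √ε with ha
  have ha0 : 0 < a := Real.sqrt_pos.2 hε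
  have ha1 : a ≤ 1 := Real.sqrt_le_one.2 hε1
  have haa : a * a = ε := Real.mul_self_sqrt hε.le
  have hrhs : ε ^ (1 / (2 * τ)) / γ ^ (1 / τ) = (a / γ) ^ (1 / τ) := by
    rw [Real.div_rpow ha0.le hγ.le, ha, Real.sqrt_eq_rpow, ← Real.rpow_mul hε.le]
    congr 2
    field_simp
  have hale : a ≤ (a / γ) ^ (1 / τ) := by
    have h1 : a ^ (1 : ℝ) ≤ a ^ (1 / τ) :=
      Real.rpow_le_rpow_of_exponent_ge ha0 ha1 (by rw [div_le_one hτ0]; exact hτ)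
    rw [Real.rpow_one] at h1
    refine h1.trans (Real.rpow_le_rpow ha0.le ?_ (by positivity))
    rw [le_div_iff₀ hγ]
    nlinarith [h.gamma_le_one]
  set N : ℕ := ⌊1 / a⌋₊ with hN
  have hN1 : 0 < N := Nat.floor_pos.2 (by rw [le_div_iff₀ ha0]; linarith)
  have hNle : (N : ℝ) ≤ 1 / a := Nat.floor_le (by positivity)
  have hNlt : 1 / a < N + 1 := Nat.lt_floor_add_one _
  obtain ⟨s, hs, hsd⟩ := Real.exists_rat_abs_sub_le_and_den_le ω hN1
  have hd : (1 : ℝ) ≤ s.den := by exact_mod_cast s.pos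
  have hd0 : (0 : ℝ) < s.den := by linarith
  have hNa : 1 / ((N : ℝ) + 1) ≤ a := by
    rw [div_lt_iff₀ ha0] at hNlt
    rw [div_le_iff₀ (by positivity)]
    linarith
  have hnum : |(s.den : ℝ) * ω - s.num| ≤ a := by
    have e : (s.den : ℝ) * ω - s.num = s.den * (ω - s) := by
      rw [Rat.cast_def]; field_simp
    rw [e, abs_mul, Nat.abs_cast]
    calc (s.den : ℝ) * |ω - s| ≤ s.den * (1 / (((N : ℝ) + 1) * s.den)) := by gcongr
      _ = 1 / ((N : ℝ) + 1) := by field_simp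
      _ ≤ a := hNa
  have hN0 : (0 : ℝ) < N + 1 := by positivity
  refine ⟨s, ?_, ?_, ?_, ?_⟩
  · have h1 : 1 / (((N : ℝ) + 1) * s.den) ≤ 1 := by
      rw [div_le_one (by positivity)]; nlinarith
    have := abs_sub_abs_le_abs_sub (s : ℝ) ω
    rw [abs_sub_comm] at this
    linarith
  · rw [hrhs]
    have h1 := hdio s.den s.num (by exact_mod_cast s.den_ne_zero)
    simp only [Int.cast_natCast, Nat.abs_cast] at h1
    have h2 : 1 / (s.den : ℝ) ^ τ ≤ a / γ := by
      rw [le_div_iff₀ hγ, one_div, inv_mul_eq_div]; linarith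
    have h3 := Real.rpow_le_rpow (by positivity) h2 (show 0 ≤ 1 / τ by positivity)
    rwa [Real.div_rpow zero_le_one (by positivity), Real.one_rpow, ← Real.rpow_mul hd0.le,
      mul_one_div_cancel hτ0.ne', Real.rpow_one] at h3
  · rw [hrhs]; exact hnum.trans hale
  · rw [hrhs]
    refine le_trans ?_ hale
    have h1 : (s.den : ℝ) ≤ 1 / a := le_trans (by exact_mod_cast hsd) hNle
    rw [le_div_iff₀ ha0] at h1
    nlinarith

end

theorem theorem1 {r : ℕ} (hr : 1 ≤ r) (S : (Fin (r + 1) → ℝ) → ℝ) (hS : IsLocalPotential S) :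
    -- the minima that define the periodic barriers are attained
    (∀ s : ℚ,
      (∃ x ∈ periodicSeqs (s.den : ℤ) s.num,
        IsMinOn (periodicAction S (s.den : ℤ)) (periodicSeqs (s.den : ℤ) s.num) x) ∧
      ∀ ξ : ℝ, ∃ x ∈ pinnedPeriodicSeqs (s.den : ℤ) s.num ξ,
        IsMinOn (periodicAction S (s.den : ℤ)) (pinnedPeriodicSeqs (s.den : ℤ) s.num ξ) x) ∧
    -- the limit that defines the quasi-periodic barrier exists
    (∀ ω : ℝ, Irrational ω → ∀ ξ : ℝ,
      Tendsto (fun s : ℚ => periodicPeierlsBarrier S s ξ)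
        (comap (fun s : ℚ => (s : ℝ)) (𝓝 ω)) (𝓝 (peierlsBarrier S ω ξ))) ∧
    (∀ L : ℝ, 0 < L → ∃ C : ℝ, 0 < C ∧
      -- the estimate, for rational and irrational `ω`
      (∀ ω : ℝ, |ω| ≤ L → ∀ p q : ℤ, p ≠ 0 → IsCoprime p q → |(q : ℝ) / (p : ℝ)| ≤ L →
        ∀ ξ : ℝ,
          |peierlsBarrier S ω ξ - periodicPeierlsBarrier S ((q : ℚ) / (p : ℚ)) ξ| ≤
            C * (1 / |(p : ℝ)| + |(p : ℝ) * ω - (q : ℝ)|)) ∧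
      -- Hölder continuity at Diophantine `ω`, uniformly in `ξ`
      (∀ γ τ ω : ℝ, IsDiophantine γ τ ω → |ω| ≤ L → ∀ Ω : ℝ, |Ω - ω| ≤ 1 → ∀ ξ : ℝ,
        |peierlsBarrier S ω ξ - peierlsBarrier S Ω ξ| ≤
          (5 * C / γ ^ (1 / τ)) * |Ω - ω| ^ (1 / (2 * τ)))) ∧
    -- continuity at irrational `ω`, uniformly in `ξ`
    (∀ ω : ℝ, Irrational ω →
      TendstoUniformly (fun Ω ξ : ℝ => peierlsBarrier S Ω ξ) (peierlsBarrier S ω) (𝓝 ω)) := by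
  refine ⟨fun s => ?_, fun ω hω ξ => tendsto_periodicPeierlsBarrier hS hω ξ, fun L _ => ?_,
    fun ω hω => tendstoUniformly_peierlsBarrier hS hω⟩
  · have hs : (0 : ℤ) < s.den := by exact_mod_cast s.pos
    exact ⟨exists_minimizer hS hs s.num, exists_pinned_minimizer hS hs s.num⟩
  · -- the rationals and the `Ω` used near a Diophantine `ω` may lie outside `[-L, L]`
    obtain ⟨C, hC0, hC⟩ := exists_peierlsBarrier_estimate hS (L + 1)
    refine ⟨C, hC0, fun ω hω p q hp hpq hL ξ => ?_, fun γ τ ω hdio hω Ω hΩ ξ => ?_⟩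
    · rw [← approxError_div hp hpq]
      exact hC ω (by linarith) _ (by push_cast; linarith) ξ
    · rcases eq_or_ne Ω ω with rfl | hne
      · rw [sub_self, abs_zero]
        have := hdio.1
        positivity
      · obtain ⟨s, hs, h1, h2, h3⟩ := hdio.exists_rat (abs_pos.2 (sub_ne_zero.2 hne)) hΩ
        set R := |Ω - ω| ^ (1 / (2 * τ)) / γ ^ (1 / τ) with hR
        have hΩL : |Ω| ≤ L + 1 := by
          have := abs_sub_abs_le_abs_sub Ω ω
          linarith
        have a1 := hC ω (by linarith) s (by linarith) ξ
        have a2 := hC Ω hΩL s (by linarith) ξ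
        have a3 := abs_sub_le (peierlsBarrier S ω ξ) (periodicPeierlsBarrier S s ξ)
          (peierlsBarrier S Ω ξ)
        rw [abs_sub_comm (periodicPeierlsBarrier S s ξ)] at a3
        have b1 : approxError s ω ≤ 2 * R := by unfold approxError; linarith
        have b2 : approxError s Ω ≤ 3 * R := by
          have h4 := abs_add_le ((s.den : ℝ) * (Ω - ω)) ((s.den : ℝ) * ω - s.num)
          rw [abs_mul, Nat.abs_cast,
            show (s.den : ℝ) * (Ω - ω) + (s.den * ω - s.num) = s.den * Ω - s.num by ring] at h4
          unfold approxError
          linarith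
        have c1 := mul_le_mul_of_nonneg_left b1 hC0.le
        have c2 := mul_le_mul_of_nonneg_left b2 hC0.le
        rw [show 5 * C / γ ^ (1 / τ) * |Ω - ω| ^ (1 / (2 * τ)) = 5 * C * R by rw [hR]; ring]
        linarith
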